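/- Let $P$ be a finite set of points in the Euclidean plane in general position: no four points of $P$ lie on the boundary of a common axis-parallel square, and no two points of $P$ have the same $x$- or the same $y$-coordinate. Write $d_\infty(p,q)=\max\{|p_x-q_x|,|p_y-q_y|\}$. Every edge $(u,v)$ between points of $P$ is the straight segment $[uv]$, with its Euclidean length $d_2(u,v)$ as weight. Let $\mathcal E$ be the complete Euclidean graph on $P$. Let $T$ be the $L_\infty$-Delaunay triangulation of $P$: distinct $u,v\in P$ are adjacent in $T$ iff some axis-parallel square (of positive side length) has $u$ and $v$ on its boundary and no point of $P$ in its interior. The four cones of a point $u$ are the four open quadrants at $u$. For every $u\in P$ and every cone of $u$ that contains a point of $P$, choose one $L_\infty$-shortest edge from $u$ to a point of $P$ in that cone, breaking ties arbitrarily; let $Y_4^\infty$ be the undirected graph on $P$ formed by the chosen edges. A subgraph $H$ of a graph $G$ on $P$ is a $t$-spanner of $G$ if for all $u,v\in P$ the (weighted shortest-path) distance from $u$ to $v$ in $H$ is at most $t$ times that in $G$. Then, for every choice made in ties, $Y_4^\infty$ is a subgraph of $T$; it is plane, that is, two distinct edges meet only in common endpoints; it is a $(1+\sqrt2)$-spanner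 of $T$; and it is a $(1+\sqrt2)\sqrt{4+2\sqrt2}$-spanner of $\mathcal E$. -/

import Mathlib

/-- The Euclidean plane; `dist` is the Euclidean distance. -/
abbrev Plane : Type := EuclideanSpace ℝ (Fin 2)

/-- The `L∞`-distance between two points of the plane. -/
def dInf (p q : Plane) : ℝ := max |p 0 - q 0| |p 1 - q 1|

/-- The point `p` lies on the boundary of the axis-parallel square with centre `c` and
half-side `r`, that is, on the square of side length `2 * r` around `c`. -/
def OnSquareBoundary (c : Plane) (r : ℝ) (p : Plane) : Prop := dInf c p = r

/-- The point `p` lies in the interior of the axis-parallel square with centre `c` and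
half-side `r`. -/
def InSquareInterior (c : Plane) (r : ℝ) (p : Plane) : Prop := dInf c p < r

/-- General position: no four points of `P` lie on the boundary of an axis-parallel square, and
no two points of `P` have the same first or the same second coordinate. -/
structure GeneralPosition (P : Finset Plane) : Prop where
  no_four_on_square : ∀ (c : Plane) (r : ℝ), 0 < r →
    {p : Plane | p ∈ P ∧ OnSquareBoundary c r p}.encard ≤ 3
  fst_ne : ∀ p ∈ P, ∀ q ∈ P, p ≠ q → p 0 ≠ q 0
  snd_ne : ∀ p ∈ P, ∀ q ∈ P, p ≠ q → p 1 ≠ q 1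

/-- The `L∞`-Delaunay triangulation of `P`: two distinct points of `P` are adjacent iff both lie
on the boundary of an axis-parallel square with no point of `P` in its interior. -/
def linftyDelaunay (P : Finset Plane) : SimpleGraph P where
  Adj u v := u ≠ v ∧ ∃ (c : Plane) (r : ℝ), 0 < r ∧
    OnSquareBoundary c r u ∧ OnSquareBoundary c r v ∧ ∀ w ∈ P, ¬ InSquareInterior c r w
  symm := ⟨fun _ _ ⟨hne, c, r, hr, hu, hv, hw⟩ => ⟨hne.symm, c, r, hr, hv, hu, hw⟩⟩
  loopless := ⟨fun _ h => h.1 rfl⟩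

/-- The complete Euclidean graph on `P`. Edges are weighted through `walkLength`. -/
def completeEuclidean (P : Finset Plane) : SimpleGraph P := ⊤

/-- The four open quadrant cones at `u`, in counterclockwise order from the first quadrant. -/
def cone (u : Plane) : Fin 4 → Set Plane
  | 0 => {p | u 0 < p 0 ∧ u 1 < p 1}
  | 1 => {p | p 0 < u 0 ∧ u 1 < p 1}
  | 2 => {p | p 0 < u 0 ∧ p 1 < u 1}
  | 3 => {p | u 0 < p 0 ∧ p 1 < u 1}

/-- `v` is a point of `P` in cone `i` of `u` at minimum `L∞`-distance from `u`. -/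
def IsNearestInCone (P : Finset Plane) (u : Plane) (i : Fin 4) (v : Plane) : Prop :=
  v ∈ P ∧ v ∈ cone u i ∧ ∀ w ∈ P, w ∈ cone u i → dInf u v ≤ dInf u w

/-- `D` is a directed `L∞` Yao graph on four cones: in every cone of every point `u` that contains
a point of `P`, exactly one `L∞`-shortest edge at `u` is chosen (ties are broken arbitrarily) and
oriented out of `u`, and `D` has no other arcs. -/
structure IsDirectedYao (P : Finset Plane) (D : Digraph P) : Prop where
  nearest : ∀ u v : P, D.Adj u v → ∃ i : Fin 4, IsNearestInCone P u i v
  chosen : ∀ (u : P) (i : Fin 4), (∃ w ∈ P, w ∈ cone u i) →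
    ∃! v : P, (v : Plane) ∈ cone u i ∧ D.Adj u v

/-- The undirected graph obtained from `D` by removing the orientations of its arcs. -/
def undirected {V : Type*} (D : Digraph V) : SimpleGraph V where
  Adj u v := u ≠ v ∧ (D.Adj u v ∨ D.Adj v u)
  symm := ⟨fun _ _ h => ⟨h.1.symm, h.2.symm⟩⟩
  loopless := ⟨fun _ h => h.1 rfl⟩

/-- `Y` is an undirected `L∞` Yao graph `Y₄^∞` of `P` (there may be several, because of ties). -/
def IsYao (P : Finset Plane) (Y : SimpleGraph P) : Prop :=
  ∃ D : Digraph P, IsDirectedYao P D ∧ Y = undirected D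

/-- The graph is plane when drawn with straight edges: two distinct edges meet only in common
endpoints. -/
def IsPlane {P : Finset Plane} (G : SimpleGraph P) : Prop :=
  ∀ a b c d : P, G.Adj a b → G.Adj c d → s(a, b) ≠ s(c, d) →
    segment ℝ (a : Plane) b ∩ segment ℝ (c : Plane) d ⊆ ({↑a, ↑b} ∩ {↑c, ↑d} : Set Plane)

/-- The Euclidean length of a walk. -/
noncomputable def walkLength {P : Finset Plane} {G : SimpleGraph P} {u v : P}
    (w : G.Walk u v) : ℝ :=
  (w.darts.map fun e => dist (e.fst : Plane) (e.snd : Plane)).sum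

/-- The distance of `u` and `v` in the graph `G` with Euclidean edge lengths: the length of a
shortest walk, and `⊤` if there is no walk. -/
noncomputable def graphDist {P : Finset Plane} (G : SimpleGraph P) (u v : P) : ENNReal :=
  ⨅ w : G.Walk u v, ENNReal.ofReal (walkLength w)

/-- `H` is a `t`-spanner of `G`. -/
def IsSpannerOf {P : Finset Plane} (t : ℝ) (H G : SimpleGraph P) : Prop :=
  H ≤ G ∧ ∀ u v : P, graphDist H u v ≤ ENNReal.ofReal t * graphDist G u v

/-! Two features of a Delaunay edge carry the argument: its endpoints share a closed square with
empty interior, and its length is at most its L₁-length and at most √2 times its L∞-length. A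
nearest point v in a quadrant of u spans such a square with corner u, so Yao edges are Delaunay
edges.

Planarity (`NoFour.endpoints_of_meet`): the open bounding box of an edge lies inside its square,
hence is empty. If two edges cross with interleaving x-ranges, the empty boxes already separate
them. If the x-ranges are nested, the two squares are forced to coincide and carry four points.

Yao against Delaunay (`YaoRelated.exists_short_detour`): if a gently sloped Delaunay edge uv is
missing, the Yao choice of u lies beyond the empty square, and the point q closest to the edge on
that side gives two Yao edges uq and qv of total length at most (1+√2)|uv|.

Delaunay against Euclid (`le_stretchBound`): with M ≥ m the coordinate differences, the distance is
at most (1+√2)M + m, by induction on M; Cauchy–Schwarz yields √(4+2√2), and the two factors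
multiply. Put b on the horizontal axis and a at (0,-κ), with D the distance from a. An empty square
grows from a and moves east, with a point h above the axis on its upper side and l below on its
lower side. While its right side is at e, the potential D h + (e - X h) + D l + (e - X l) + side ≤
4e holds. A point on the right side can be reached through h or l, and the average of the two
L₁-costs is at most 2e. Thus meeting b finishes the proof. A point met by a gently sloped edge
across the axis is paid for by the √2-bound, and a staircase leads from there to b (`finish_low`).
Otherwise the potential persists. -/

/-! ### Empty squares and the staircase to the target. -/

section AbstractPoints

variable {ι : Type*}

/-- No point with coordinates `(X p, Y p)` lies in the open rectangle `(x₀, x₁) × (y₀, y₁)`. -/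
def EmptyRect (X Y : ι → ℝ) (x₀ x₁ y₀ y₁ : ℝ) : Prop :=
  ∀ p, x₀ < X p → X p < x₁ → y₀ < Y p → Y p < y₁ → False

/-- The points `p` and `q` lie in a common closed square without points in its interior. -/
def SquareEdge (X Y : ι → ℝ) (p q : ι) : Prop :=
  ∃ x y s : ℝ, 0 < s ∧ EmptyRect X Y x (x + s) y (y + s) ∧
    (x ≤ X p ∧ X p ≤ x + s ∧ y ≤ Y p ∧ Y p ≤ y + s) ∧
    (x ≤ X q ∧ X q ≤ x + s ∧ y ≤ Y q ∧ Y q ≤ y + s)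

lemma EmptyRect.mono {X Y : ι → ℝ} {x₀ x₁ y₀ y₁ x₀' x₁' y₀' y₁' : ℝ}
    (h : EmptyRect X Y x₀ x₁ y₀ y₁) (hx₀ : x₀ ≤ x₀') (hx₁ : x₁' ≤ x₁) (hy₀ : y₀ ≤ y₀')
    (hy₁ : y₁' ≤ y₁) : EmptyRect X Y x₀' x₁' y₀' y₁' :=
  fun p h₁ h₂ h₃ h₄ => h p (by linarith) (by linarith) (by linarith) (by linarith)

lemma EmptyRect.neg_right {X Y : ι → ℝ} {x₀ x₁ y₀ y₁ : ℝ}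
    (h : EmptyRect X Y x₀ x₁ y₀ y₁) : EmptyRect X (fun p => -Y p) x₀ x₁ (-y₁) (-y₀) :=
  fun p h₁ h₂ h₃ h₄ => h p h₁ h₂ (by linarith) (by linarith)

lemma SquareEdge.symm {X Y : ι → ℝ} {p q : ι} (h : SquareEdge X Y p q) : SquareEdge X Y q p := by
  obtain ⟨x, y, s, hs, he, hp, hq⟩ := h
  exact ⟨x, y, s, hs, he, hq, hp⟩

lemma SquareEdge.swap {X Y : ι → ℝ} {p q : ι} (h : SquareEdge X Y p q) : SquareEdge Y X p q := by
  obtain ⟨x, y, s, hs, he, hp, hq⟩ := h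
  exact ⟨y, x, s, hs, fun r h₁ h₂ h₃ h₄ => he r h₃ h₄ h₁ h₂,
    ⟨hp.2.2.1, hp.2.2.2, hp.1, hp.2.1⟩, ⟨hq.2.2.1, hq.2.2.2, hq.1, hq.2.1⟩⟩

lemma SquareEdge.neg_right {X Y : ι → ℝ} {p q : ι} (h : SquareEdge X Y p q) :
    SquareEdge X (fun p => -Y p) p q := by
  obtain ⟨x, y, s, hs, he, hp, hq⟩ := h
  refine ⟨x, -(y + s), s, hs, fun r h₁ h₂ h₃ h₄ => he r h₁ h₂ ?_ ?_, ⟨hp.1, hp.2.1, ?_, ?_⟩,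
    ⟨hq.1, hq.2.1, ?_, ?_⟩⟩ <;> linarith [hp.2.2.1, hp.2.2.2, hq.2.2.1, hq.2.2.2]

lemma SquareEdge.sub_right {X Y : ι → ℝ} {p q : ι} (h : SquareEdge X Y p q) (c : ℝ) :
    SquareEdge X (fun p => Y p - c) p q := by
  obtain ⟨x, y, s, hs, he, hp, hq⟩ := h
  refine ⟨x, y - c, s, hs, fun r h₁ h₂ h₃ h₄ => he r h₁ h₂ ?_ ?_, ⟨hp.1, hp.2.1, ?_, ?_⟩,
    ⟨hq.1, hq.2.1, ?_, ?_⟩⟩ <;> linarith [hp.2.2.1, hp.2.2.2, hq.2.2.1, hq.2.2.2]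

/-- The function `D` increases along an edge at most by the `L₁`-length and at most by `√2` times
the `L∞`-length of the edge. -/
structure EdgeLipschitz (X Y D : ι → ℝ) : Prop where
  le_add : ∀ p q, SquareEdge X Y p q → D q ≤ D p + |X q - X p| + |Y q - Y p|
  le_max : ∀ p q, SquareEdge X Y p q → D q ≤ D p + √2 * max |X q - X p| |Y q - Y p|

lemma EdgeLipschitz.neg_right {X Y D : ι → ℝ} (h : EdgeLipschitz X Y D) :
    EdgeLipschitz X (fun p => -Y p) D := by
  have key : ∀ p q, SquareEdge X (fun p => -Y p) p q → SquareEdge X Y p q := fun p q hpq => by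
    simpa using hpq.neg_right
  have habs : ∀ p q, |-Y q - -Y p| = |Y q - Y p| := fun p q => by
    rw [← abs_neg]; congr 1; ring
  refine ⟨fun p q hpq => ?_, fun p q hpq => ?_⟩
  · simpa only [habs] using h.le_add p q (key p q hpq)
  · simpa only [habs] using h.le_max p q (key p q hpq)

/-- From each gently sloped point between the vertical axis and `b`, the bound for `b` follows. -/
def GentleBound (X Y D : ι → ℝ) (b : ι) : Prop :=
  ∀ p, 0 < X p → X p ≤ X b → |Y p| ≤ X b - X p →
    D b ≤ D p + (1 + √2) * (X b - X p) + |Y p|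

lemma GentleBound.neg_right {X Y D : ι → ℝ} {b : ι} (h : GentleBound X Y D b) :
    GentleBound X (fun p => -Y p) D b := by
  intro p h₁ h₂ h₃
  simp only [abs_neg] at h₃ ⊢
  exact h p h₁ h₂ h₃

/-- An edge climbing towards the axis raises `D - Y` by at most its horizontal extent, so the bound
on `D q - Y q` survives. While `q` is steep as seen from `b`, the empty square can slide east to the
next point without losing `q`, which gives such an edge. Hence at the highest admissible `q` either
`GentleBound` applies or the next point is `b`. -/
lemma finish_low [Finite ι] {X Y D : ι → ℝ} {b : ι} {κ : ℝ} (hY : Function.Injective Y)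
    (hb : Y b = 0) (hD : EdgeLipschitz X Y D) (hG : GentleBound X Y D b)
    {q : ι} {e : ℝ} (hq : 0 < X q) (hqe : X q ≤ e) (heb : e ≤ X b) (hqY : Y q < 0)
    (hqD : D q - Y q ≤ (1 + √2) * X q + κ) (hE : EmptyRect X Y (e + Y q) e (Y q) 0) :
    D b ≤ (1 + √2) * X b + κ := by
  have h2 : (1 : ℝ) ≤ √2 := Real.one_le_sqrt.2 (by norm_num)
  let S : Set ι := {q | ∃ e, 0 < X q ∧ X q ≤ e ∧ e ≤ X b ∧ Y q < 0 ∧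
    D q - Y q ≤ (1 + √2) * X q + κ ∧ EmptyRect X Y (e + Y q) e (Y q) 0}
  have hS : S.Nonempty := ⟨q, e, hq, hqe, heb, hqY, hqD, hE⟩
  obtain ⟨q, ⟨e, hq, hqe, heb, hqY, hqD, hE⟩, hmax⟩ := Set.exists_max_image S Y S.toFinite hS
  by_cases hg : -Y q ≤ X b - X q
  · have := hG q hq (hqe.trans heb) (by rwa [abs_of_neg hqY])
    rw [abs_of_neg hqY] at this
    linarith
  push Not at hg
  let U : Set ι := {p | Y q < Y p ∧ Y p ≤ 0 ∧ e ≤ X p}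
  obtain ⟨p, ⟨hp1, hp2, hp3⟩, hmin⟩ := Set.exists_min_image U X U.toFinite
    ⟨b, by rw [hb]; exact hqY, hb.le, heb⟩
  have hpb : X p ≤ X b := hmin b ⟨by rw [hb]; exact hqY, hb.le, heb⟩
  have hempty : EmptyRect X Y (X p + Y q) (X p) (Y q) 0 := by
    intro r h₁ h₂ h₃ h₄
    by_cases hr : X r < e
    · exact hE r (by linarith) hr h₃ h₄
    · exact absurd (hmin r ⟨h₃, h₄.le, not_lt.1 hr⟩) (not_le.2 h₂)
  have hedge : SquareEdge X Y q p :=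
    ⟨X p + Y q, Y q, -Y q, by linarith, hempty.mono (by linarith) (by linarith) le_rfl
      (by linarith), ⟨by linarith, by linarith, le_rfl, by linarith⟩,
      ⟨by linarith, by linarith, hp1.le, by linarith⟩⟩
  have hDp := hD.le_add q p hedge
  rw [abs_of_nonneg (by linarith), abs_of_nonneg (by linarith)] at hDp
  have hmul : 1 * (X p - X q) ≤ √2 * (X p - X q) :=
    mul_le_mul_of_nonneg_right h2 (by linarith)
  have hDone : D p - Y p ≤ (1 + √2) * X p + κ := by linarith
  rcases hp2.eq_or_lt with h0 | h0
  · have : p = b := hY (h0.trans hb.symm)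
    subst this
    linarith
  · have := hmax p ⟨X p, by linarith, le_rfl, hpb, h0, hDone,
      hempty.mono (by linarith) le_rfl hp1.le le_rfl⟩
    linarith

lemma finish_high [Finite ι] {X Y D : ι → ℝ} {b : ι} {κ : ℝ} (hY : Function.Injective Y)
    (hb : Y b = 0) (hD : EdgeLipschitz X Y D) (hG : GentleBound X Y D b)
    {q : ι} {e : ℝ} (hq : 0 < X q) (hqe : X q ≤ e) (heb : e ≤ X b) (hqY : 0 < Y q)
    (hqD : D q + Y q ≤ (1 + √2) * X q + κ) (hE : EmptyRect X Y (e - Y q) e 0 (Y q)) :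
    D b ≤ (1 + √2) * X b + κ :=
  finish_low (Y := fun p => -Y p) (neg_injective.comp hY) (by simp [hb]) hD.neg_right
    hG.neg_right hq hqe heb (by simpa using hqY) (by simpa using hqD) (by simpa [sub_eq_add_neg] using hE.neg_right)

/-! ### The sweep with an empty square. -/

/-- A square with `h` on its upper side, `l` on its lower side, right side at abscissa `e`, and no
points in its interior, together with the bounds on `D h` and `D l` that the sweep maintains. -/
structure SweepState (X Y D : ι → ℝ) (b : ι) (κ : ℝ) (h l : ι) (e : ℝ) : Prop where
  high : 0 < Y h
  low : Y l < 0
  high_nonneg : 0 ≤ X h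
  low_nonneg : 0 ≤ X l
  pos : 0 < e
  high_le : X h ≤ e
  low_le : X l ≤ e
  le_target : e ≤ X b
  le_high : e - (Y h - Y l) ≤ X h
  le_low : e - (Y h - Y l) ≤ X l
  empty : EmptyRect X Y (e - (Y h - Y l)) e (Y l) (Y h)
  bound_high : D h ≤ 2 * X h + Y h + κ
  bound_low : D l ≤ 2 * X l - Y l + κ
  potential : D h + D l + (Y h - Y l) ≤ 2 * e + X h + X l

lemma SweepState.neg_right {X Y D : ι → ℝ} {b : ι} {κ : ℝ} {h l : ι} {e : ℝ}
    (H : SweepState X Y D b κ h l e) : SweepState X (fun p => -Y p) D b κ l h e := by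
  have hs : -Y l - -Y h = Y h - Y l := by ring
  obtain ⟨h1, h2, h3, h4, h5, h6, h7, h8, h9, h10, h11, h12, h13, h14⟩ := H
  refine ⟨by linarith, by linarith, h4, h3, h5, h7, h6, h8, by linarith, by linarith, ?_,
    by linarith, by linarith, by linarith⟩
  simp only [hs]
  exact h11.neg_right

/-- The sweep either establishes the bound for `b` or moves on. -/
def SweepProgress (X Y D : ι → ℝ) (b : ι) (κ : ℝ) (h l : ι) : Prop :=
  D b ≤ (1 + √2) * X b + κ ∨
    ∃ h' l' e', SweepState X Y D b κ h' l' e' ∧ X h + X l < X h' + X l'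

lemma SweepProgress.of_neg_right {X Y D : ι → ℝ} {b : ι} {κ : ℝ} {h l : ι}
    (H : SweepProgress X (fun p => -Y p) D b κ l h) : SweepProgress X Y D b κ h l := by
  rcases H with H | ⟨h', l', e', H, hlt⟩
  · exact Or.inl H
  · refine Or.inr ⟨l', h', e', ?_, by linarith⟩
    simpa using H.neg_right

/-- Sliding a square to the east until it meets a point `p` below `b`. -/
lemma SweepState.progress_of_slide_low [Finite ι] {X Y D : ι → ℝ} {b : ι} {κ : ℝ}
    (hX : Function.Injective X) (hY : Function.Injective Y) (hb : Y b = 0) (hκ : 0 ≤ κ)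
    (hD : EdgeLipschitz X Y D)
    (hG : GentleBound X Y D b) {h l p : ι} {e : ℝ} (H : SweepState X Y D b κ h l e)
    (hp1 : Y l < Y p) (hp2 : Y p ≤ 0) (hpe : e ≤ X p) (hpb : X p ≤ X b)
    (hph : X p - (Y h - Y l) ≤ X h) (hpl : X p - (Y h - Y l) ≤ X l)
    (hE : EmptyRect X Y (X p - (Y h - Y l)) (X p) (Y l) (Y h)) :
    SweepProgress X Y D b κ h l := by
  obtain ⟨h1, h2, h3, h4, h5, h6, h7, h8, h9, h10, h11, h12, h13, h14⟩ := H
  have h2' : (1 : ℝ) ≤ √2 := Real.one_le_sqrt.2 (by norm_num)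
  have hs : 0 < Y h - Y l := by linarith
  have hE' : EmptyRect X Y (X p - (Y h - Y l)) (X p - (Y h - Y l) + (Y h - Y l)) (Y l)
      (Y l + (Y h - Y l)) := hE.mono le_rfl (by linarith) le_rfl (by linarith)
  have ehp : SquareEdge X Y h p := ⟨_, _, _, hs, hE',
    ⟨by linarith, by linarith, by linarith, by linarith⟩,
    ⟨by linarith, by linarith, by linarith, by linarith⟩⟩
  have elp : SquareEdge X Y l p := ⟨_, _, _, hs, hE',
    ⟨by linarith, by linarith, by linarith, by linarith⟩,
    ⟨by linarith, by linarith, by linarith, by linarith⟩⟩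
  have d1 := hD.le_add h p ehp
  have d2 := hD.le_add l p elp
  rw [abs_of_nonneg (by linarith), abs_of_nonpos (by linarith)] at d1
  rw [abs_of_nonneg (by linarith), abs_of_nonneg (by linarith)] at d2
  -- The vertical costs from `h` and from `l` add up to the side length, so the sum of `d1` and `d2`
  -- is controlled by `potential`, and `e ≤ X p`.
  have hDp : D p ≤ 2 * X p := by linarith
  rcases hp2.eq_or_lt with h0 | h0
  · left
    have : p = b := hY (h0.trans hb.symm)
    subst this
    nlinarith
  -- For a gentle edge from `h`, the drop `Y h - Y p` is at most `X p - X h`; with the √2-bound and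
  -- `bound_high` this gives the input of `finish_low`. Failure of the test says that the smaller
  -- square with lower right corner `p` still contains `h`.
  by_cases hg : Y h - Y p ≤ X p - X h
  · left
    have d3 := hD.le_max h p ehp
    rw [abs_of_nonneg (by linarith), abs_of_nonpos (by linarith), max_eq_left (by linarith)] at d3
    have hm : 1 * X h ≤ √2 * X h := mul_le_mul_of_nonneg_right h2' h3
    exact finish_low hY hb hD hG (by linarith) le_rfl hpb h0 (by linarith)
      (hE.mono (by linarith) le_rfl hp1.le h1.le)
  · right
    have hne : X l ≠ X p := fun hlp => by rw [hX hlp] at hp1; exact lt_irrefl _ hp1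
    have hlt : X l < X p := lt_of_le_of_ne (by linarith) hne
    exact ⟨h, p, X p, ⟨h1, h0, h3, by linarith, by linarith, by linarith, le_rfl, hpb, by linarith,
      by linarith, hE.mono (by linarith) le_rfl hp1.le le_rfl, h12, by linarith, by linarith⟩,
      by linarith⟩

/-- Growing a square with fixed upper left corner until it meets a point. -/
lemma SweepState.progress_of_grow [Finite ι] {X Y D : ι → ℝ} {b : ι} {κ : ℝ}
    (hY : Function.Injective Y) (hb : Y b = 0) (hκ : 0 ≤ κ)
    (hD : EdgeLipschitz X Y D)
    (hG : GentleBound X Y D b) {h l : ι} {e : ℝ} (H : SweepState X Y D b κ h l e)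
    (hlh : X l ≤ X h) (hlb : X l + (Y h - Y l) < X b)
    (hE : EmptyRect X Y (X l) (X l + (Y h - Y l)) (Y l) (Y h)) :
    SweepProgress X Y D b κ h l := by
  obtain ⟨h1, h2, h3, h4, h5, h6, h7, h8, h9, h10, h11, h12, h13, h14⟩ := H
  have h2' : (1 : ℝ) ≤ √2 := Real.one_le_sqrt.2 (by norm_num)
  have hs : 0 < Y h - Y l := by linarith
  let U : Set ι := {p | X l < X p ∧ Y p < Y h}
  have hbU : b ∈ U := ⟨by linarith, by linarith⟩
  obtain ⟨p, ⟨hp1, hp2⟩, hmin⟩ := Set.exists_min_image U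
    (fun p => max (X p - X l) (Y h - Y p)) U.toFinite ⟨b, hbU⟩
  have htb := hmin b hbU
  simp only [hb] at htb
  rw [max_eq_left (a := X b - X l) (by linarith)] at htb
  set t := max (X p - X l) (Y h - Y p) with ht
  have ht1 : X p - X l ≤ t := le_max_left _ _
  have ht2 : Y h - Y p ≤ t := le_max_right _ _
  have hst : Y h - Y l ≤ t := by
    by_contra hlt
    push Not at hlt
    exact hE p hp1 (by linarith) (by linarith) hp2
  have hempty : EmptyRect X Y (X l) (X l + t) (Y h - t) (Y h) := by
    intro r r1 r2 r3 r4
    exact absurd (hmin r ⟨r1, r4⟩) (not_le.2 (max_lt (by linarith) (by linarith)))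
  have hempty' : EmptyRect X Y (X l) (X l + t) (Y h - t) (Y h - t + t) :=
    hempty.mono le_rfl le_rfl le_rfl (by linarith)
  have ehp : SquareEdge X Y h p := ⟨_, _, _, by linarith, hempty',
    ⟨by linarith, by linarith, by linarith, by linarith⟩,
    ⟨by linarith, by linarith, by linarith, by linarith⟩⟩
  have elp : SquareEdge X Y l p := ⟨_, _, _, by linarith, hempty',
    ⟨by linarith, by linarith, by linarith, by linarith⟩,
    ⟨by linarith, by linarith, by linarith, by linarith⟩⟩
  have d2 := hD.le_add l p elp
  rw [abs_of_nonneg (a := X p - X l) (by linarith)] at d2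
  rcases le_or_gt 0 (Y p) with h0 | h0
  · left
    -- As `Y l < 0 ≤ Y p`, the vertical gap is below the old side length, so `p` is met by the right
    -- side.
    have hxp : t = X p - X l := by
      rcases max_choice (X p - X l) (Y h - Y p) with hc | hc <;> rw [← ht] at hc
      · exact hc
      · linarith
    have d3 := hD.le_max l p elp
    rw [abs_of_nonneg (by linarith), abs_of_nonneg (by linarith), max_eq_left (by linarith)] at d3
    have hm : 1 * X l ≤ √2 * X l := mul_le_mul_of_nonneg_right h2' h4
    rcases h0.eq_or_lt with h0 | h0
    · have : p = b := hY (h0.symm.trans hb.symm)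
      subst this
      linarith
    · exact finish_high hY hb hD hG (by linarith) le_rfl (by linarith) h0 (by linarith)
        (hempty.mono (by linarith) (by linarith) (by linarith) hp2.le)
  by_cases hg : Y h - Y p ≤ X p - X h
  · left
    have d3 := hD.le_max h p ehp
    rw [abs_of_nonneg (by linarith), abs_of_nonpos (by linarith), max_eq_left (by linarith)] at d3
    have hm : 1 * X h ≤ √2 * X h := mul_le_mul_of_nonneg_right h2' h3
    have hxp : t = X p - X l := by
      rw [ht]; exact max_eq_left (by linarith)
    exact finish_low hY hb hD hG (by linarith) le_rfl (by linarith) h0 (by linarith)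
      (hempty.mono (by linarith) (by linarith) (by linarith) h1.le)
  · right
    push Not at hg
    have hcase : t = X p - X l ∨ t = Y h - Y p := max_choice _ _
    -- A point below `l` is paid for from `l` alone; a point met by the right side is paid for by
    -- the average of the routes through `h` and `l`.
    have hbp : D p ≤ 2 * X p - Y p + κ := by
      rcases le_total (Y p) (Y l) with hpl | hpl
      · rw [abs_of_nonpos (by linarith)] at d2
        linarith
      · have hxp : t = X p - X l := by
          rcases hcase with hc | hc
          · exact hc
          · exact absurd (hY (le_antisymm hpl (by linarith))) (fun hl => by
              rw [hl] at hp1; exact lt_irrefl _ hp1)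
        have d1 := hD.le_add h p ehp
        rw [abs_of_nonneg (by linarith), abs_of_nonpos (by linarith)] at d1
        rw [abs_of_nonneg (by linarith)] at d2
        linarith
    -- A descent below `l` counts twice, in `D p` and in the side length; the shift of the right
    -- side absorbs it, since `e + (Y l - Y p) ≤ X l + t`.
    have hpot : D h + D p + (Y h - Y p) ≤ 2 * (X l + t) + X h + X p := by
      rcases le_total (Y p) (Y l) with hpl | hpl
      · rw [abs_of_nonpos (by linarith)] at d2
        linarith
      · rw [abs_of_nonneg (by linarith)] at d2
        linarith
    refine ⟨h, p, X l + t, ⟨h1, h0, h3, by linarith, by linarith, by linarith, by linarith,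
      by linarith, ?_, ?_, hempty.mono (by linarith) le_rfl (by linarith) le_rfl, h12, hbp,
      hpot⟩, by linarith⟩
    · rcases hcase with hc | hc <;> linarith
    · rcases hcase with hc | hc <;> linarith

/-- The square slides east to the next point of its strip unless `h` or `l` would drop out on the
left first. In that case the left side stops at the leftmost of the two, and the square grows from
the left corner on the opposite horizontal side. -/
lemma SweepState.progress [Finite ι] {X Y D : ι → ℝ} {b : ι} {κ : ℝ}
    (hX : Function.Injective X) (hY : Function.Injective Y) (hb : Y b = 0) (hκ : 0 ≤ κ)
    (hD : EdgeLipschitz X Y D)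
    (hG : GentleBound X Y D b) {h l : ι} {e : ℝ} (H : SweepState X Y D b κ h l e) :
    SweepProgress X Y D b κ h l := by
  have hXe := H.high_le
  have hYe := H.low_le
  have hlow := H.low
  have hhigh := H.high
  let U : Set ι := {p | Y l < Y p ∧ Y p < Y h ∧ e ≤ X p}
  have hbU : b ∈ U := ⟨by linarith, by linarith, H.le_target⟩
  obtain ⟨p, ⟨hp1, hp2, hp3⟩, hmin⟩ := Set.exists_min_image U X U.toFinite ⟨b, hbU⟩
  have hpb : X p ≤ X b := hmin b hbU
  have hempty : ∀ x₀ x₁, e - (Y h - Y l) ≤ x₀ → x₁ ≤ X p → EmptyRect X Y x₀ x₁ (Y l) (Y h) := by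
    intro x₀ x₁ hx₀ hx₁ r r1 r2 r3 r4
    by_cases hr : X r < e
    · exact H.empty r (by linarith) hr r3 r4
    · exact absurd (hmin r ⟨r3, r4, not_lt.1 hr⟩) (by linarith)
  by_cases hslide : X p - (Y h - Y l) ≤ X h ∧ X p - (Y h - Y l) ≤ X l
  · rcases le_total (Y p) 0 with h0 | h0
    · exact H.progress_of_slide_low hX hY hb hκ hD hG hp1 h0 hp3 hpb hslide.1 hslide.2
        (hempty _ _ (by linarith) le_rfl)
    · refine SweepProgress.of_neg_right (H.neg_right.progress_of_slide_low (Y := fun p => -Y p) hX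
        (neg_injective.comp hY) (by simp [hb]) hκ hD.neg_right hG.neg_right (p := p)
        (by linarith) (by linarith) hp3 hpb (by linarith) (by linarith) ?_)
      have := (hempty (X p - (Y h - Y l)) _ (by linarith) le_rfl).neg_right
      rwa [show -Y l - -Y h = Y h - Y l by ring]
  rcases le_total (X l) (X h) with hlh | hlh
  · have hlt : X l + (Y h - Y l) < X p := by
      by_contra hc
      exact hslide ⟨by linarith, by linarith⟩
    exact H.progress_of_grow hY hb hκ hD hG hlh (by linarith)
      (hempty _ _ H.le_low hlt.le)
  · have hlt : X h + (Y h - Y l) < X p := by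
      by_contra hc
      exact hslide ⟨by linarith, by linarith⟩
    refine SweepProgress.of_neg_right (H.neg_right.progress_of_grow (Y := fun p => -Y p)
      (neg_injective.comp hY) (by simp [hb]) hκ hD.neg_right hG.neg_right hlh (by linarith) ?_)
    rw [show -Y l - -Y h = Y h - Y l by ring]
    exact (hempty _ _ H.le_high hlt.le).neg_right

/-- Every move increases `X h + X l` and there are finitely many pairs, so a maximal pair can only
finish. -/
lemma SweepState.bound [Finite ι] {X Y D : ι → ℝ} {b : ι} {κ : ℝ}
    (hX : Function.Injective X) (hY : Function.Injective Y) (hb : Y b = 0) (hκ : 0 ≤ κ)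
    (hD : EdgeLipschitz X Y D)
    (hG : GentleBound X Y D b) {h l : ι} {e : ℝ} (H : SweepState X Y D b κ h l e) :
    D b ≤ (1 + √2) * X b + κ := by
  let S : Set (ι × ι) := {q | ∃ e, SweepState X Y D b κ q.1 q.2 e}
  obtain ⟨⟨h, l⟩, ⟨e, H⟩, hmax⟩ := Set.exists_max_image S (fun q => X q.1 + X q.2) S.toFinite
    ⟨(h, l), e, H⟩
  rcases H.progress hX hY hb hκ hD hG with hdone | ⟨h', l', e', H', hlt⟩
  · exact hdone
  · exact absurd (hmax (h', l') ⟨e', H'⟩) (not_le.2 hlt)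

/-- The bound for `b = (X b, 0)` starting at `a = (0, -κ)`, given the bound for closer points. -/
lemma sweep_bound [Finite ι] {X Y D : ι → ℝ} {a b : ι} {κ : ℝ}
    (hX : Function.Injective X) (hY : Function.Injective Y) (hb : Y b = 0) (hκ : 0 < κ)
    (hD : EdgeLipschitz X Y D) (hG : GentleBound X Y D b) (haX : X a = 0) (haY : Y a = -κ)
    (hDa : D a = 0) (hκb : κ ≤ X b)
    (hbox : ∀ p, 0 < X p → X p ≤ X b → -κ < Y p → Y p ≤ 0 → X b - X p ≤ -Y p →
      D b ≤ D p + (1 + √2) * (-Y p) + (X b - X p)) :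
    D b ≤ (1 + √2) * X b + κ := by
  have h2' : (1 : ℝ) ≤ √2 := Real.one_le_sqrt.2 (by norm_num)
  let U : Set ι := {p | 0 < X p ∧ -κ < Y p}
  have hbU : b ∈ U := ⟨by linarith, by linarith⟩
  -- `p` is the first point met by a square growing from its lower left corner `a`. As `κ ≤ X b`, it
  -- is met at side length at most `X b`.
  obtain ⟨p, ⟨hp1, hp2⟩, hmin⟩ := Set.exists_min_image U
    (fun p => max (X p) (Y p + κ)) U.toFinite ⟨b, hbU⟩
  have htb := hmin b hbU
  simp only [hb] at htb
  rw [max_eq_left (a := X b) (by linarith)] at htb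
  set t := max (X p) (Y p + κ) with ht
  have ht1 : X p ≤ t := le_max_left _ _
  have ht2 : Y p + κ ≤ t := le_max_right _ _
  have hempty : EmptyRect X Y 0 t (-κ) (t - κ) := by
    intro r r1 r2 r3 r4
    exact absurd (hmin r ⟨r1, r3⟩) (not_le.2 (max_lt (by linarith) (by linarith)))
  have eap : SquareEdge X Y a p := ⟨0, -κ, t, by linarith,
    hempty.mono le_rfl (by linarith) le_rfl (by linarith),
    ⟨by linarith, by linarith, by linarith, by linarith⟩,
    ⟨by linarith, by linarith, by linarith, by linarith⟩⟩
  have d1 := hD.le_add a p eap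
  rw [abs_of_nonneg (by linarith), abs_of_nonneg (by linarith), haX, haY, hDa] at d1
  rcases le_or_gt (Y p) 0 with h0 | h0
  · rcases le_total (X b - X p) (-Y p) with hg | hg
    · have := hbox p hp1 (by linarith) hp2 h0 hg
      have hm : √2 * (-Y p) ≤ √2 * X b := mul_le_mul_of_nonneg_left (by linarith) (by linarith)
      linarith
    · have := hG p hp1 (by linarith) (by rwa [abs_of_nonpos h0])
      rw [abs_of_nonpos h0] at this
      have hm : 1 * X p ≤ √2 * X p := mul_le_mul_of_nonneg_right h2' hp1.le
      linarith
  by_cases hg : Y p + κ ≤ X p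
  · have hxp : t = X p := max_eq_left hg
    have d3 := hD.le_max a p eap
    rw [abs_of_nonneg (by linarith), abs_of_nonneg (by linarith), haX, haY, hDa,
      max_eq_left (by linarith)] at d3
    exact finish_high hY hb hD hG hp1 le_rfl (by linarith) h0 (by linarith)
      (hempty.mono (by linarith) (by linarith) (by linarith) (by linarith))
  · push Not at hg
    have hyp : t = Y p + κ := max_eq_right hg.le
    -- For a steep `p` above the axis, `a` itself serves as the low point; the potential reduces to
    -- `D p ≤ X p + t`.
    have H : SweepState X Y D b κ p a t := by
      refine ⟨h0, by linarith, hp1.le, by linarith, by linarith, by linarith, by linarith, htb,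
        by linarith, by linarith, ?_, by linarith, by linarith, by linarith⟩
      exact hempty.mono (by linarith) le_rfl (by linarith) (by linarith)
    exact H.bound hX hY hb hκ.le hD hG

end AbstractPoints

/-! ### Induction on the L∞-distance. -/

section Stretch

variable {ι : Type*}

lemma SquareEdge.of_neg_right {X Y : ι → ℝ} {p q : ι}
    (h : SquareEdge X (fun p => -Y p) p q) : SquareEdge X Y p q := by
  simpa using h.neg_right

lemma SquareEdge.of_neg_left {X Y : ι → ℝ} {p q : ι}
    (h : SquareEdge (fun p => -X p) Y p q) : SquareEdge X Y p q :=
  h.swap.of_neg_right.swap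

lemma EdgeLipschitz.swap {X Y D : ι → ℝ} (h : EdgeLipschitz X Y D) : EdgeLipschitz Y X D :=
  ⟨fun p q hpq => by linarith [h.le_add p q hpq.swap],
    fun p q hpq => by rw [max_comm]; exact h.le_max p q hpq.swap⟩

lemma EdgeLipschitz.sub_right {X Y D : ι → ℝ} (h : EdgeLipschitz X Y D) (c : ℝ) :
    EdgeLipschitz X (fun p => Y p - c) D := by
  have key : ∀ p q, SquareEdge X (fun p => Y p - c) p q → SquareEdge X Y p q := fun p q hpq => by
    simpa using hpq.sub_right (-c)
  exact ⟨fun p q hpq => by simpa using h.le_add p q (key p q hpq),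
    fun p q hpq => by simpa using h.le_max p q (key p q hpq)⟩

/-- The bound on the stretch, as a function of the coordinate differences. -/
noncomputable def stretchBound (x y : ℝ) : ℝ := (1 + √2) * max |x| |y| + min |x| |y|

lemma stretchBound_comm (x y : ℝ) : stretchBound x y = stretchBound y x := by
  rw [stretchBound, stretchBound, max_comm, min_comm]

lemma stretchBound_of_le {x y : ℝ} (h : |y| ≤ |x|) :
    stretchBound x y = (1 + √2) * |x| + |y| := by
  rw [stretchBound, max_eq_left h, min_eq_right h]

/-- The bound on the stretch holds for all points at smaller `L∞`-distance from `b` than `a`. -/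
def CloserBound (X Y D : ι → ℝ) (a b : ι) : Prop :=
  ∀ p, max |X b - X p| |Y b - Y p| < max |X b - X a| |Y b - Y a| →
    D b ≤ D p + stretchBound (X b - X p) (Y b - Y p)

lemma CloserBound.swap {X Y D : ι → ℝ} {a b : ι} (h : CloserBound X Y D a b) :
    CloserBound Y X D a b := by
  intro p hp
  rw [stretchBound_comm]
  exact h p (by rwa [max_comm, max_comm |X b - X a|])

lemma CloserBound.neg_right {X Y D : ι → ℝ} {a b : ι} (h : CloserBound X Y D a b) :
    CloserBound X (fun p => -Y p) D a b := by
  have habs : ∀ p, |-Y b - -Y p| = |Y b - Y p| := fun p => by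
    rw [← abs_neg]; congr 1; ring
  intro p hp
  simp only [stretchBound, habs] at hp ⊢
  exact h p hp

/-- With the origin at `(X a, Y b)` and `κ = Y b - Y a` this is `sweep_bound`. The points in its
hypotheses lie strictly to the right of `a` and are vertically closer to `b` than `X b - X a`, so
the induction hypothesis covers them. -/
lemma CloserBound.stretch_of_quadrant [Finite ι] {X Y D : ι → ℝ} {a b : ι}
    (hX : Function.Injective X) (hY : Function.Injective Y) (hD : EdgeLipschitz X Y D)
    (hDa : D a = 0) (h : CloserBound X Y D a b) (hXab : X a < X b) (hYab : Y a < Y b)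
    (hg : Y b - Y a ≤ X b - X a) : D b ≤ stretchBound (X b - X a) (Y b - Y a) := by
  have hmax : max |X b - X a| |Y b - Y a| = X b - X a := by
    rw [abs_of_pos (by linarith), abs_of_pos (by linarith), max_eq_left hg]
  have hD' : EdgeLipschitz (fun p => X p - X a) (fun p => Y p - Y b) D :=
    ((hD.sub_right (Y b)).swap.sub_right (X a)).swap
  have hclose : ∀ p, 0 < X p - X a → X p - X a ≤ X b - X a → |Y p - Y b| < X b - X a →
      D b ≤ D p + stretchBound (X b - X p) (Y b - Y p) := fun p h1 h2 h3 => by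
    refine h p ?_
    rw [hmax, abs_of_nonneg (by linarith), abs_sub_comm (Y b)]
    exact max_lt (by linarith) h3
  rw [stretchBound_of_le (by rwa [abs_of_pos (by linarith), abs_of_pos (by linarith)]),
    abs_of_pos (by linarith), abs_of_pos (by linarith)]
  refine sweep_bound (a := a) (b := b) (X := fun p => X p - X a) (Y := fun p => Y p - Y b)
    (fun p q hpq => hX (by simpa using hpq)) (fun p q hpq => hY (by simpa using hpq)) (by simp)
    (by linarith) hD' ?_ (by simp) (by ring) hDa hg ?_
  · intro p h1 h2 h3
    have := hclose p h1 h2 (by linarith)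
    rw [stretchBound_of_le, abs_of_nonneg (by linarith), abs_sub_comm (Y b)] at this
    · simp only [sub_sub_sub_cancel_right]
      linarith
    · rw [abs_sub_comm, abs_of_nonneg (a := X b - X p) (by linarith)]
      linarith
  · intro p h1 h2 h3 h4 h5
    have := hclose p h1 h2 (by rw [abs_of_nonpos h4]; linarith)
    rw [stretchBound_comm, stretchBound_of_le, abs_of_nonneg (by linarith),
      abs_of_nonneg (by linarith)] at this
    · linarith
    · rw [abs_of_nonneg (by linarith), abs_of_nonneg (by linarith)]
      linarith

lemma stretchBound_neg_right (x y z : ℝ) :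
    stretchBound x (-y - -z) = stretchBound x (y - z) := by
  rw [stretchBound, stretchBound, show -y - -z = -(y - z) by ring, abs_neg]

/-- Axis reflections and the swap of coordinates preserve squares and reduce every position of `b`
to a gentle one in the first quadrant of `a`. -/
lemma CloserBound.stretch [Finite ι] {X Y D : ι → ℝ} {a b : ι}
    (hX : Function.Injective X) (hY : Function.Injective Y) (hD : EdgeLipschitz X Y D)
    (hDa : D a = 0) (hab : a ≠ b) (h : CloserBound X Y D a b) :
    D b ≤ stretchBound (X b - X a) (Y b - Y a) := by
  have half : ∀ {X Y : ι → ℝ}, Function.Injective X → Function.Injective Y →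
      EdgeLipschitz X Y D → CloserBound X Y D a b → X a < X b → |Y b - Y a| ≤ X b - X a →
      D b ≤ stretchBound (X b - X a) (Y b - Y a) := by
    intro X Y hX hY hD h hXab hg
    rcases lt_or_gt_of_ne (hY.ne hab) with hYab | hYab
    · exact h.stretch_of_quadrant hX hY hD hDa hXab hYab ((le_abs_self _).trans hg)
    · have := h.neg_right.stretch_of_quadrant (Y := fun p => -Y p) hX (neg_injective.comp hY) hD.neg_right hDa hXab
        (by simpa using hYab) (by linarith [neg_le_abs (Y b - Y a)])
      rwa [stretchBound_neg_right] at this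
  have gentle : ∀ {X Y : ι → ℝ}, Function.Injective X → Function.Injective Y →
      EdgeLipschitz X Y D → CloserBound X Y D a b → |Y b - Y a| ≤ |X b - X a| →
      D b ≤ stretchBound (X b - X a) (Y b - Y a) := by
    intro X Y hX hY hD h hg
    rcases lt_or_gt_of_ne (hX.ne hab) with hXab | hXab
    · exact half hX hY hD h hXab (by rwa [abs_of_pos (a := X b - X a) (by linarith)] at hg)
    · have := half (X := fun p => -X p) (neg_injective.comp hX) hY hD.swap.neg_right.swap
        h.swap.neg_right.swap (by simpa using hXab)
        (by rw [abs_of_neg (a := X b - X a) (by linarith)] at hg; linarith)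
      rwa [stretchBound_comm, stretchBound_neg_right, stretchBound_comm] at this
  rcases le_total |Y b - Y a| |X b - X a| with hg | hg
  · exact gentle hX hY hD h hg
  · rw [stretchBound_comm]
    exact gentle hY hX hD.swap h.swap hg

/-- The stretch factor of the `L∞`-Delaunay triangulation, for an abstract distance function. -/
theorem le_stretchBound [Finite ι] {X Y : ι → ℝ} (hX : Function.Injective X)
    (hY : Function.Injective Y) {d : ι → ι → ℝ} (hself : ∀ p, d p p = 0)
    (htri : ∀ p q r, d p r ≤ d p q + d q r) (hD : ∀ p, EdgeLipschitz X Y (d p)) (a b : ι) :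
    d a b ≤ stretchBound (X b - X a) (Y b - Y a) := by
  by_contra hcon
  let S : Set (ι × ι) := {q | ¬ d q.1 q.2 ≤ stretchBound (X q.2 - X q.1) (Y q.2 - Y q.1)}
  obtain ⟨⟨a, b⟩, hab, hmin⟩ := Set.exists_min_image S
    (fun q => max |X q.2 - X q.1| |Y q.2 - Y q.1|) S.toFinite ⟨(a, b), hcon⟩
  refine hab ?_
  by_cases hne : a = b
  · subst hne
    simp [hself, stretchBound]
  -- Minimality of the counterexample bounds `d p b` for every closer `p`; the triangle inequality
  -- turns this into `CloserBound`.
  refine CloserBound.stretch hX hY (hD a) (hself a) hne fun p hp => ?_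
  have : d p b ≤ stretchBound (X b - X p) (Y b - Y p) := by
    by_contra hc
    exact absurd (hmin (p, b) hc) (not_le.2 hp)
  linarith [htri a p b]

end Stretch

/-! ### Replacing a Delaunay edge by two Yao edges. -/

section YaoDetour

variable {ι : Type*}

/-- In the first quadrant of every point `u` that contains a point, some point of that quadrant
nearest to `u` in the `L∞`-distance is related to `u`. -/
def NearestRelated (X Y : ι → ℝ) (A : ι → ι → Prop) : Prop :=
  ∀ u, (∃ w, X u < X w ∧ Y u < Y w) → ∃ v, X u < X v ∧ Y u < Y v ∧ A u v ∧
    ∀ w, X u < X w → Y u < Y w → max (X v - X u) (Y v - Y u) ≤ max (X w - X u) (Y w - Y u)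

/-- The property `NearestRelated` for all four quadrants. -/
structure YaoRelated (X Y : ι → ℝ) (A : ι → ι → Prop) : Prop where
  symm : ∀ u v, A u v → A v u
  ne : NearestRelated X Y A
  nw : NearestRelated (fun p => -X p) Y A
  sw : NearestRelated (fun p => -X p) (fun p => -Y p) A
  se : NearestRelated X (fun p => -Y p) A

lemma NearestRelated.swap {X Y : ι → ℝ} {A : ι → ι → Prop} (h : NearestRelated X Y A) :
    NearestRelated Y X A := by
  rintro u ⟨w, h1, h2⟩
  obtain ⟨v, hv1, hv2, hv3, hv4⟩ := h u ⟨w, h2, h1⟩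
  refine ⟨v, hv2, hv1, hv3, fun w h1 h2 => ?_⟩
  rw [max_comm, max_comm (Y w - Y u)]
  exact hv4 w h2 h1

lemma YaoRelated.swap {X Y : ι → ℝ} {A : ι → ι → Prop} (h : YaoRelated X Y A) :
    YaoRelated Y X A :=
  ⟨h.symm, h.ne.swap, h.se.swap, h.sw.swap, h.nw.swap⟩

lemma YaoRelated.neg_right {X Y : ι → ℝ} {A : ι → ι → Prop} (h : YaoRelated X Y A) :
    YaoRelated X (fun p => -Y p) A :=
  ⟨h.symm, h.se, h.sw, by simpa using h.nw, by simpa using h.ne⟩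

/-- The choice `w` of `u` must lie above the empty square. Let `q` be the lowest point above `v` in
the vertical strip between `u` and `v`; the strip below `q` is then empty down to the bottom of the
square. This forces the choices: if `uq` is gentle, `q` chooses `u`, otherwise `w = q`; if `qv` is
gentle, `q` chooses `v`, otherwise `v` chooses `q`. -/
lemma YaoRelated.exists_detour [Finite ι] {X Y : ι → ℝ} {A : ι → ι → Prop}
    (hX : Function.Injective X) (hY : Function.Injective Y) (hA : YaoRelated X Y A) {u v : ι}
    (huv : SquareEdge X Y u v) (hXuv : X u < X v) (hYuv : Y u < Y v)
    (hg : Y v - Y u ≤ X v - X u) : A u v ∨ ∃ q, A u q ∧ A q v ∧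
      X u ≤ X q ∧ X q ≤ X v ∧ Y v ≤ Y q ∧ Y q ≤ Y u + (X v - X u) := by
  by_cases huvA : A u v
  · exact Or.inl huvA
  obtain ⟨x, y, s, hs, hE, ⟨hu1, hu2, hu3, hu4⟩, ⟨hv1, hv2, hv3, hv4⟩⟩ := huv
  have hempty : EmptyRect X Y (X u) (X v) y (y + s) := hE.mono hu1 hv2 le_rfl le_rfl
  obtain ⟨w, hw1, hw2, hw3, hw4⟩ := hA.ne u ⟨v, hXuv, hYuv⟩
  have hwv := hw4 v hXuv hYuv
  rw [max_eq_left hg] at hwv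
  have hw5 := (le_max_left _ _).trans hwv
  have hw6 := (le_max_right _ _).trans hwv
  have hwne : w ≠ v := fun hwv => huvA (hwv ▸ hw3)
  have hw7 : X w < X v := lt_of_le_of_ne (by linarith) (hX.ne hwne)
  have hw8 : Y v < Y w := by
    by_contra hc
    rcases (not_lt.1 hc).eq_or_lt with hc | hc
    · exact hwne (hY hc)
    · exact hempty w hw1 hw7 (by linarith) (by linarith)
  let U : Set ι := {p | X u < X p ∧ X p < X v ∧ Y v < Y p}
  have hwU : w ∈ U := ⟨hw1, hw7, hw8⟩
  obtain ⟨q, ⟨hq1, hq2, hq3⟩, hmin⟩ := Set.exists_min_image U Y U.toFinite ⟨w, hwU⟩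
  have hqw : Y q ≤ Y w := hmin w hwU
  have hqs : y + s ≤ Y q := by
    by_contra hc
    exact hempty q hq1 hq2 (by linarith) (by linarith)
  have hrect : EmptyRect X Y (X u) (X v) y (Y q) := by
    intro p p1 p2 p3 p4
    rcases lt_trichotomy (Y p) (Y v) with hp | hp | hp
    · exact hempty p p1 p2 p3 (by linarith)
    · rw [hY hp] at p2; exact lt_irrefl _ p2
    · exact absurd (hmin p ⟨p1, p2, hp⟩) (by linarith)
  refine Or.inr ⟨q, ?_, ?_, hq1.le, hq2.le, hq3.le, by linarith⟩
  · by_cases hgq : Y q - Y u ≤ X q - X u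
    · obtain ⟨z, hz1, hz2, hz3, hz4⟩ := hA.sw q ⟨u, by simpa using hq1, by simp; linarith⟩
      have hzu := hz4 u (by simpa using hq1) (by simp; linarith)
      rw [max_eq_left (a := -X u - -X q) (by linarith)] at hzu
      have hz5 := (le_max_left _ _).trans hzu
      have hz6 := (le_max_right _ _).trans hzu
      rcases (show X u ≤ X z by linarith).eq_or_lt with hc | hc
      · rw [hX hc]; exact hA.symm _ _ hz3
      · exact (hrect z hc (by linarith) (by linarith) (by linarith)).elim
    · push Not at hgq
      have hwq := hw4 q hq1 (by linarith)
      rw [max_eq_right (a := X q - X u) (by linarith)] at hwq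
      have := (le_max_right _ _).trans hwq
      rw [hY (le_antisymm hqw (by linarith))]
      exact hw3
  · rcases le_total (Y q - Y v) (X v - X q) with hgq | hgq
    · obtain ⟨z, hz1, hz2, hz3, hz4⟩ := hA.se q ⟨v, hq2, by simpa using hq3⟩
      have hzu := hz4 v hq2 (by simpa using hq3)
      rw [max_eq_left (a := X v - X q) (by linarith)] at hzu
      have hz5 := (le_max_left _ _).trans hzu
      have hz6 := (le_max_right _ _).trans hzu
      rcases (show X z ≤ X v by linarith).eq_or_lt with hc | hc
      · rw [← hX hc]; exact hz3
      · exact (hrect z (by linarith) hc (by linarith) (by linarith)).elim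
    · obtain ⟨z, hz1, hz2, hz3, hz4⟩ := hA.nw v ⟨q, by simpa using hq2, hq3⟩
      have hzu := hz4 q (by simpa using hq2) hq3
      rw [max_eq_right (b := Y q - Y v) (by linarith)] at hzu
      have hz5 := (le_max_left _ _).trans hzu
      have hz6 := (le_max_right _ _).trans hzu
      rcases (show Y z ≤ Y q by linarith).eq_or_lt with hc | hc
      · rw [← hY hc]; exact hA.symm _ _ hz3
      · exact (hrect z (by linarith) (by linarith) (by linarith) hc).elim

/-- Both legs have vertical extent at most `x`. The convex function `r ↦ √(r² + x²)` lies below its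
chord `x + (√2 - 1) r` on `[0, x]`, and the horizontal extents of the legs add up to `x`, so the sum
is at most `(1 + √2) x`. -/
lemma sqrt_add_sqrt_le_of_mem_box {x y p q : ℝ} (hp : 0 ≤ p) (hpx : p ≤ x) (hy : 0 ≤ y)
    (hyq : y ≤ q) (hqx : q ≤ x) :
    √(p ^ 2 + q ^ 2) + √((x - p) ^ 2 + (y - q) ^ 2) ≤ (1 + √2) * √(x ^ 2 + y ^ 2) := by
  have hx : 0 ≤ x := hp.trans hpx
  have h1 : (1 : ℝ) ≤ √2 := Real.one_le_sqrt.2 (by norm_num)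
  have h2 : √2 ^ 2 = 2 := Real.sq_sqrt (by norm_num)
  have chord : ∀ r t : ℝ, 0 ≤ r → r ≤ x → t ^ 2 ≤ x ^ 2 →
      √(r ^ 2 + t ^ 2) ≤ x + (√2 - 1) * r := by
    intro r t hr hrx ht
    have h0 : 0 ≤ (√2 - 1) * r := mul_nonneg (by linarith) hr
    refine (Real.sqrt_le_left (by linarith)).2 ?_
    · have : 0 ≤ (√2 - 1) * (r * (x - r)) :=
        mul_nonneg (by linarith) (mul_nonneg hr (by linarith))
      nlinarith
  have c1 := chord p q hp hpx (by nlinarith)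
  have c2 := chord (x - p) (y - q) (by linarith) (by linarith) (by nlinarith)
  have c3 : x ≤ √(x ^ 2 + y ^ 2) := Real.le_sqrt_of_sq_le (by nlinarith)
  have c4 : (1 + √2) * x ≤ (1 + √2) * √(x ^ 2 + y ^ 2) :=
    mul_le_mul_of_nonneg_left c3 (by linarith)
  linarith

/-- Every edge of the Delaunay triangulation has a detour of at most two Yao edges. -/
theorem YaoRelated.exists_short_detour [Finite ι] {X Y : ι → ℝ} {A : ι → ι → Prop}
    (hX : Function.Injective X) (hY : Function.Injective Y) (hA : YaoRelated X Y A) {u v : ι}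
    (hne : u ≠ v) (huv : SquareEdge X Y u v) : A u v ∨ ∃ q, A u q ∧ A q v ∧
      √((X q - X u) ^ 2 + (Y q - Y u) ^ 2) + √((X v - X q) ^ 2 + (Y v - Y q) ^ 2) ≤
        (1 + √2) * √((X v - X u) ^ 2 + (Y v - Y u) ^ 2) := by
  have half : ∀ {X Y : ι → ℝ}, Function.Injective X → Function.Injective Y → YaoRelated X Y A →
      ∀ {u v : ι}, u ≠ v → SquareEdge X Y u v → X u < X v → |Y v - Y u| ≤ X v - X u →
      A u v ∨ ∃ q, A u q ∧ A q v ∧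
      √((X q - X u) ^ 2 + (Y q - Y u) ^ 2) + √((X v - X q) ^ 2 + (Y v - Y q) ^ 2) ≤
        (1 + √2) * √((X v - X u) ^ 2 + (Y v - Y u) ^ 2) := by
    intro X Y hX hY hA u v hne huv hXuv hg
    rcases lt_or_gt_of_ne (hY.ne hne) with hYuv | hYuv
    · refine (hA.exists_detour hX hY huv hXuv hYuv ((le_abs_self _).trans hg)).imp_right ?_
      rintro ⟨q, h1, h2, h3, h4, h5, h6⟩
      refine ⟨q, h1, h2, ?_⟩
      have := sqrt_add_sqrt_le_of_mem_box (x := X v - X u) (y := Y v - Y u) (p := X q - X u)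
        (q := Y q - Y u) (by linarith) (by linarith) (by linarith) (by linarith) (by linarith)
      simpa using this
    · refine (hA.neg_right.exists_detour (Y := fun p => -Y p) hX (neg_injective.comp hY) huv.neg_right hXuv
        (by simpa using hYuv) (by linarith [neg_le_abs (Y v - Y u)])).imp_right ?_
      rintro ⟨q, h1, h2, h3, h4, h5, h6⟩
      refine ⟨q, h1, h2, ?_⟩
      have := sqrt_add_sqrt_le_of_mem_box (x := X v - X u) (y := Y u - Y v) (p := X q - X u)
        (q := Y u - Y q) (by linarith) (by linarith) (by linarith) (by linarith) (by linarith)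
      convert this using 4 <;> ring
  have gentle : ∀ {X Y : ι → ℝ}, Function.Injective X → Function.Injective Y →
      YaoRelated X Y A → SquareEdge X Y u v → |Y v - Y u| ≤ |X v - X u| →
      A u v ∨ ∃ q, A u q ∧ A q v ∧
      √((X q - X u) ^ 2 + (Y q - Y u) ^ 2) + √((X v - X q) ^ 2 + (Y v - Y q) ^ 2) ≤
        (1 + √2) * √((X v - X u) ^ 2 + (Y v - Y u) ^ 2) := by
    intro X Y hX hY hA huv hg
    rcases lt_or_gt_of_ne (hX.ne hne) with hXuv | hXuv
    · exact half hX hY hA hne huv hXuv (by rwa [abs_of_pos (a := X v - X u) (by linarith)] at hg)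
    · rw [abs_sub_comm, abs_of_neg (a := X v - X u) (by linarith)] at hg
      refine (half hX hY hA hne.symm huv.symm hXuv (by linarith)).imp (hA.symm _ _) ?_
      rintro ⟨q, h1, h2, h3⟩
      refine ⟨q, hA.symm _ _ h2, hA.symm _ _ h1, ?_⟩
      rw [add_comm]
      convert h3 using 4 <;> ring
  rcases le_total |Y v - Y u| |X v - X u| with hg | hg
  · exact gentle hX hY hA huv hg
  · refine (gentle hY hX hA.swap huv.swap hg).imp_right ?_
    rintro ⟨q, h1, h2, h3⟩
    refine ⟨q, h1, h2, ?_⟩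
    simpa only [add_comm ((Y _ - Y _) ^ 2)] using h3

end YaoDetour

/-! ### Edges with empty squares do not cross. -/

section Crossing

variable {ι : Type*}

lemma strictly_between {u v s : ℝ} (huv : u ≠ v) (hs0 : 0 < s) (hs1 : s < 1) :
    (u < u + s * (v - u) ∧ u + s * (v - u) < v) ∨
      (v < u + s * (v - u) ∧ u + s * (v - u) < u) := by
  rcases lt_or_gt_of_ne huv with h | h
  · left; constructor <;> nlinarith
  · right; constructor <;> nlinarith

/-- The point `p` lies in the open bounding box of `a` and `b`. -/
def InBox (X Y : ι → ℝ) (a b p : ι) : Prop :=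
  X a < X p ∧ X p < X b ∧ ((Y a < Y p ∧ Y p < Y b) ∨ (Y b < Y p ∧ Y p < Y a))

lemma SquareEdge.not_inBox {X Y : ι → ℝ} {a b p : ι} (h : SquareEdge X Y a b) :
    ¬ InBox X Y a b p := by
  rintro ⟨h1, h2, h3⟩
  obtain ⟨x, y, s, hs, he, ha, hb⟩ := h
  rcases h3 with h3 | h3 <;>
    exact he p (by linarith) (by linarith) (by linarith) (by linarith)

/-- No four points lie in a closed square with empty interior. -/
def NoFour (X Y : ι → ℝ) : Prop :=
  ∀ x y s : ℝ, 0 < s → EmptyRect X Y x (x + s) y (y + s) → ∀ f : Fin 4 → ι, Function.Injective f →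
    ¬ ∀ i, x ≤ X (f i) ∧ X (f i) ≤ x + s ∧ y ≤ Y (f i) ∧ Y (f i) ≤ y + s

lemma injective_fin_four {a b c d : ι} (hab : a ≠ b) (hac : a ≠ c) (had : a ≠ d) (hbc : b ≠ c)
    (hbd : b ≠ d) (hcd : c ≠ d) : Function.Injective ![a, b, c, d] := by
  intro i j hij
  fin_cases i <;> fin_cases j <;> simp_all [eq_comm]

/-- The empty box of `ab` puts `c` below and `d` above both `a` and `b`. Then `c` and `d` lie
outside the open vertical range of the square of `ab`, and `a` and `b` outside the open horizontal
range of the square of `cd`. -/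
lemma NoFour.not_nested_of_lt {X Y : ι → ℝ} (hY : Function.Injective Y) (hN : NoFour X Y)
    {a b c d : ι}
    (hab : SquareEdge X Y a b) (hcd : SquareEdge X Y c d) (hac : X a < X c) (hcd' : X c < X d)
    (hdb : X d < X b) {zy : ℝ} (hzab : (Y a < zy ∧ zy < Y b) ∨ (Y b < zy ∧ zy < Y a))
    (hc : Y c < zy) (hd : zy < Y d) : False := by
  have hca := hY.ne (a₁ := c) (a₂ := a) (by rintro rfl; exact lt_irrefl _ hac)
  have hcb := hY.ne (a₁ := c) (a₂ := b) (by rintro rfl; linarith)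
  have hda := hY.ne (a₁ := d) (a₂ := a) (by rintro rfl; linarith)
  have hdb' := hY.ne (a₁ := d) (a₂ := b) (by rintro rfl; exact lt_irrefl _ hdb)
  have hcbox := hab.not_inBox (p := c)
  have hdbox := hab.not_inBox (p := d)
  have hcab : Y c < Y a ∧ Y c < Y b := by
    constructor <;>
    · by_contra hcon
      refine hcbox ⟨by linarith, by linarith, ?_⟩
      have := lt_of_le_of_ne (not_lt.1 hcon) (Ne.symm (by assumption))
      rcases hzab with h | h
      · exact Or.inl ⟨by linarith, by linarith⟩
      · exact Or.inr ⟨by linarith, by linarith⟩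
  have hdab : Y a < Y d ∧ Y b < Y d := by
    constructor <;>
    · by_contra hcon
      refine hdbox ⟨by linarith, by linarith, ?_⟩
      have := lt_of_le_of_ne (not_lt.1 hcon) (by assumption)
      rcases hzab with h | h
      · exact Or.inl ⟨by linarith, by linarith⟩
      · exact Or.inr ⟨by linarith, by linarith⟩
  obtain ⟨x, y, s, hs, he, ⟨ha1, ha2, ha3, ha4⟩, ⟨hb1, hb2, hb3, hb4⟩⟩ := hab
  obtain ⟨x', y', s', hs', he', ⟨hc1, hc2, hc3, hc4⟩, ⟨hd1, hd2, hd3, hd4⟩⟩ := hcd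
  have hcy : Y c ≤ y := by
    by_contra hcon
    exact he c (by linarith) (by linarith) (by linarith) (by linarith)
  have hdy : y + s ≤ Y d := by
    by_contra hcon
    exact he d (by linarith) (by linarith) (by linarith) (by linarith)
  have hax : X a ≤ x' := by
    by_contra hcon
    exact he' a (by linarith) (by linarith) (by linarith) (by linarith)
  have hbx : x' + s' ≤ X b := by
    by_contra hcon
    exact he' b (by linarith) (by linarith) (by linarith) (by linarith)
  -- Now `s ≤ Y d - Y c ≤ s' ≤ X b - X a ≤ s`: the two squares coincide and contain all four points.
  refine hN x y s hs he ![a, b, c, d] (injective_fin_four ?_ ?_ ?_ ?_ ?_ ?_) fun i => ?_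
  any_goals rintro rfl; linarith
  fin_cases i <;> simp <;> refine ⟨?_, ?_, ?_, ?_⟩ <;> linarith

lemma NoFour.not_nested {X Y : ι → ℝ} (hY : Function.Injective Y) (hN : NoFour X Y)
    {a b c d : ι}
    (hab : SquareEdge X Y a b) (hcd : SquareEdge X Y c d) (hac : X a < X c) (hcd' : X c < X d)
    (hdb : X d < X b) {zy : ℝ} (hzab : (Y a < zy ∧ zy < Y b) ∨ (Y b < zy ∧ zy < Y a))
    (hzcd : (Y c < zy ∧ zy < Y d) ∨ (Y d < zy ∧ zy < Y c)) : False := by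
  rcases hzcd with h | h
  · exact hN.not_nested_of_lt hY hab hcd hac hcd' hdb hzab h.1 h.2
  · refine NoFour.not_nested_of_lt (Y := fun p => -Y p) (zy := -zy) (neg_injective.comp hY) ?_
      hab.neg_right hcd.neg_right hac hcd' hdb ?_ (by linarith [h.2]) (by linarith [h.1])
    · intro x y s hs he f hf hmem
      have he' := he.neg_right
      simp only [neg_neg] at he'
      refine hN x (-(y + s)) s hs (he'.mono le_rfl le_rfl le_rfl (by linarith)) f hf fun i => ?_
      obtain ⟨h1, h2, h3, h4⟩ := hmem i
      exact ⟨h1, h2, by linarith, by linarith⟩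
    · rcases hzab with h | h
      · exact Or.inr ⟨by linarith, by linarith⟩
      · exact Or.inl ⟨by linarith, by linarith⟩

lemma InBox.of_neg_right {X Y : ι → ℝ} {a b p : ι} (h : InBox X (fun p => -Y p) a b p) :
    InBox X Y a b p :=
  ⟨h.1, h.2.1, h.2.2.symm.imp (fun h => ⟨by linarith [h.1], by linarith [h.2]⟩)
    fun h => ⟨by linarith [h.1], by linarith [h.2]⟩⟩

/-- As `c` avoids the box of `ab` and `b` the box of `cd`, the edge `cd` also rises, with `c` not
above `a` and `d` not above `b`. So `a` and `b` lie strictly above the line `cd`. -/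
lemma not_overlap_of_lt {X Y : ι → ℝ} (hY : Function.Injective Y) {a b c d : ι}
    (hc : ¬ InBox X Y a b c) (hb : ¬ InBox X Y c d b)
    (hac : X a < X c) (hbd : X b < X d) {zx zy t s : ℝ} (hzx : X c < zx ∧ zx < X b)
    (hzab : Y a < zy ∧ zy < Y b)
    (hzcd : (Y c < zy ∧ zy < Y d) ∨ (Y d < zy ∧ zy < Y c))
    (ht0 : 0 < t) (ht1 : t < 1)
    (hx1 : zx = X a + t * (X b - X a)) (hx2 : zx = X c + s * (X d - X c))
    (hy1 : zy = Y a + t * (Y b - Y a)) (hy2 : zy = Y c + s * (Y d - Y c)) : False := by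
  -- The cross product with `d - c` vanishes at the crossing point, a convex combination of `a` and
  -- `b`; the line is based at `c` for `a` and at `d` for `b`.
  have hcomb : (1 - t) * ((Y d - Y c) * (X a - X c) - (X d - X c) * (Y a - Y c)) +
        t * ((Y d - Y c) * (X b - X d) - (X d - X c) * (Y b - Y d)) = 0 := by
    have : (Y d - Y c) * (zx - X c) - (X d - X c) * (zy - Y c) = 0 := by rw [hx2, hy2]; ring
    rw [hx1, hy1] at this
    linarith
  have hX : 0 < X d - X c := by linarith
  have hYd : Y c < Y d ∧ Y d ≤ Y b := by
    rcases hzcd with h' | h'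
    · refine ⟨by linarith, ?_⟩
      by_contra hcon
      exact hb ⟨by linarith, by linarith, Or.inl ⟨by linarith, by linarith⟩⟩
    · exfalso
      rcases lt_trichotomy (Y c) (Y b) with hcb | hcb | hcb
      · exact hc ⟨by linarith, by linarith, Or.inl ⟨by linarith, hcb⟩⟩
      · rw [hY hcb] at hzx; linarith
      · exact hb ⟨by linarith, by linarith, Or.inr ⟨by linarith, by linarith⟩⟩
  have hYc : Y c ≤ Y a := by
    by_contra hcon
    exact hc ⟨by linarith, by linarith, Or.inl ⟨by linarith, by linarith⟩⟩
  have f1 : (Y d - Y c) * (X a - X c) - (X d - X c) * (Y a - Y c) < 0 := by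
    have := mul_pos (sub_pos.2 hYd.1) (sub_pos.2 hac)
    have := mul_nonneg hX.le (sub_nonneg.2 hYc)
    linarith
  have f2 : (Y d - Y c) * (X b - X d) - (X d - X c) * (Y b - Y d) < 0 := by
    have := mul_pos (sub_pos.2 hYd.1) (sub_pos.2 hbd)
    have := mul_nonneg hX.le (sub_nonneg.2 hYd.2)
    linarith
  linarith [mul_neg_of_pos_of_neg (sub_pos.2 ht1) f1, mul_neg_of_pos_of_neg ht0 f2]

lemma not_overlap {X Y : ι → ℝ} (hY : Function.Injective Y) {a b c d : ι}
    (hc : ¬ InBox X Y a b c) (hb : ¬ InBox X Y c d b)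
    (hac : X a < X c) (hbd : X b < X d) {zx zy t s : ℝ} (hzx : X c < zx ∧ zx < X b)
    (hzab : (Y a < zy ∧ zy < Y b) ∨ (Y b < zy ∧ zy < Y a))
    (hzcd : (Y c < zy ∧ zy < Y d) ∨ (Y d < zy ∧ zy < Y c))
    (ht0 : 0 < t) (ht1 : t < 1)
    (hx1 : zx = X a + t * (X b - X a)) (hx2 : zx = X c + s * (X d - X c))
    (hy1 : zy = Y a + t * (Y b - Y a)) (hy2 : zy = Y c + s * (Y d - Y c)) : False := by
  rcases hzab with h | h
  · exact not_overlap_of_lt hY hc hb hac hbd hzx h hzcd ht0 ht1 hx1 hx2 hy1 hy2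
  · refine not_overlap_of_lt (Y := fun p => -Y p) (zy := -zy) (neg_injective.comp hY)
      (fun h => hc h.of_neg_right) (fun h => hb h.of_neg_right) hac hbd hzx
      ⟨by linarith [h.2], by linarith [h.1]⟩ (hzcd.symm.imp ?_ ?_) ht0 ht1 hx1 hx2
      (by rw [hy1]; ring) (by rw [hy2]; ring)
    · exact fun h => ⟨by linarith [h.2], by linarith [h.1]⟩
    · exact fun h => ⟨by linarith [h.2], by linarith [h.1]⟩

/-- Two segments with a common endpoint and another common point: one lies inside the other. -/
lemma between_of_mul_eq {u v t s : ℝ} (hs : 0 < s) (hst : s < t) (h : t * u = s * v)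
    (hv : v ≠ 0) : (0 < u ∧ u < v) ∨ (v < u ∧ u < 0) := by
  have hu : u = s / t * v := by
    field_simp [(hs.trans hst).ne']
    linarith
  have h0 : 0 < s / t := div_pos hs (hs.trans hst)
  have h1 : s / t < 1 := (div_lt_one (hs.trans hst)).2 hst
  rcases lt_or_gt_of_ne hv with h | h
  · right; constructor <;> nlinarith
  · left; constructor <;> nlinarith

lemma inBox_of_mul_eq {X Y : ι → ℝ} (hY : Function.Injective Y) {a b c : ι}
    (hac : X a < X c) {t s : ℝ} (hs : 0 < s) (hst : s < t)
    (hx : t * (X b - X a) = s * (X c - X a)) (hy : t * (Y b - Y a) = s * (Y c - Y a)) :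
    InBox X Y a c b := by
  have hne : Y c ≠ Y a := hY.ne (by rintro rfl; exact lt_irrefl _ hac)
  refine ⟨?_, ?_, ?_⟩
  · rcases between_of_mul_eq hs hst hx (sub_ne_zero.2 hac.ne') with h | h <;> linarith
  · rcases between_of_mul_eq hs hst hx (sub_ne_zero.2 hac.ne') with h | h <;> linarith
  · exact (between_of_mul_eq hs hst hy (sub_ne_zero.2 hne)).imp
      (fun h => ⟨by linarith [h.1], by linarith [h.2]⟩)
      fun h => ⟨by linarith [h.1], by linarith [h.2]⟩

lemma inBox_of_mul_eq' {X Y : ι → ℝ} (hY : Function.Injective Y) {a b c : ι}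
    (hac : X c < X a) {t s : ℝ} (hs : 0 < s) (hst : s < t)
    (hx : t * (X b - X a) = s * (X c - X a)) (hy : t * (Y b - Y a) = s * (Y c - Y a)) :
    InBox X Y c a b := by
  have h := inBox_of_mul_eq (X := fun p => -X p) hY (a := a) (b := b) (c := c) (by linarith)
    hs hst (by linarith) hy
  exact ⟨by linarith [h.2.1], by linarith [h.1], h.2.2.symm⟩

/-- If two edges with empty squares meet, they meet in endpoints. -/
theorem NoFour.endpoints_of_meet {X Y : ι → ℝ} (hX : Function.Injective X)
    (hY : Function.Injective Y) (hN : NoFour X Y) {a b c d : ι} (hab : SquareEdge X Y a b)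
    (hcd : SquareEdge X Y c d) (hXab : X a < X b) (hXcd : X c < X d) (hne : ¬ (a = c ∧ b = d))
    {t s : ℝ} (ht0 : 0 ≤ t) (ht1 : t ≤ 1) (hs0 : 0 ≤ s) (hs1 : s ≤ 1)
    (hx : X a + t * (X b - X a) = X c + s * (X d - X c))
    (hy : Y a + t * (Y b - Y a) = Y c + s * (Y d - Y c)) :
    (t = 0 ∨ t = 1) ∧ (s = 0 ∨ s = 1) := by
  have hYab : Y a ≠ Y b := hY.ne (by rintro rfl; exact lt_irrefl _ hXab)
  have hYcd : Y c ≠ Y d := hY.ne (by rintro rfl; exact lt_irrefl _ hXcd)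
  have endpoint : ∀ {a b c d : ι} {t s : ℝ}, SquareEdge X Y c d → X c < X d → Y c ≠ Y d →
      0 ≤ s → s ≤ 1 → X a + t * (X b - X a) = X c + s * (X d - X c) →
      Y a + t * (Y b - Y a) = Y c + s * (Y d - Y c) → (t = 0 ∨ t = 1) → s = 0 ∨ s = 1 := by
    intro a b c d t s hcd hXcd hYcd hs0 hs1 hx hy ht
    by_contra hs
    push Not at hs
    have hs0' := lt_of_le_of_ne hs0 hs.1.symm
    have hs1' := lt_of_le_of_ne hs1 hs.2
    have bx := strictly_between hXcd.ne hs0' hs1'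
    have by' := strictly_between hYcd hs0' hs1'
    rw [← hx] at bx
    rw [← hy] at by'
    have bx' := bx.resolve_right (fun h => by linarith [h.1, h.2])
    rcases ht with rfl | rfl
    · simp only [zero_mul, add_zero] at bx' by'
      exact hcd.not_inBox (p := a) ⟨bx'.1, bx'.2, by'⟩
    · simp only [one_mul, add_sub_cancel] at bx' by'
      exact hcd.not_inBox (p := b) ⟨bx'.1, bx'.2, by'⟩
  by_cases ht : t = 0 ∨ t = 1
  · exact ⟨ht, endpoint hcd hXcd hYcd hs0 hs1 hx hy ht⟩
  by_cases hs : s = 0 ∨ s = 1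
  · exact ⟨endpoint hab hXab hYab ht0 ht1 hx.symm hy.symm hs, hs⟩
  exfalso
  push Not at hs ht
  replace hs0 := lt_of_le_of_ne hs0 hs.1.symm
  replace hs1 := lt_of_le_of_ne hs1 hs.2
  replace ht0 := lt_of_le_of_ne ht0 ht.1.symm
  replace ht1 := lt_of_le_of_ne ht1 ht.2
  by_cases hac : a = c
  · subst hac
    rcases lt_trichotomy s t with hst | hst | hst
    · exact hcd.not_inBox (inBox_of_mul_eq hY hXcd hs0 hst (b := b) (by linarith) (by linarith))
    · subst hst
      exact hne ⟨rfl, hX (by nlinarith)⟩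
    · exact hab.not_inBox (inBox_of_mul_eq hY hXab ht0 hst (b := d) (by linarith) (by linarith))
  by_cases hbd : b = d
  · subst hbd
    rcases lt_trichotomy s t with hst | hst | hst
    · exact hab.not_inBox (inBox_of_mul_eq' hY hXab (t := 1 - s) (s := 1 - t) (b := c)
        (by linarith) (by linarith) (by linarith) (by linarith))
    · subst hst
      exact hac (hX (by nlinarith))
    · exact hcd.not_inBox (inBox_of_mul_eq' hY hXcd (t := 1 - t) (s := 1 - s) (b := a)
        (by linarith) (by linarith) (by linarith) (by linarith))
  have bxab := (strictly_between hXab.ne ht0 ht1).resolve_right (fun h => by linarith [h.1, h.2])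
  have bxcd := (strictly_between hXcd.ne hs0 hs1).resolve_right (fun h => by linarith [h.1, h.2])
  have byab := strictly_between hYab ht0 ht1
  have bycd := strictly_between hYcd hs0 hs1
  rw [← hx] at bxcd
  rw [← hy] at bycd
  rcases lt_or_gt_of_ne (hX.ne hac) with h1 | h1 <;> rcases lt_or_gt_of_ne (hX.ne hbd) with h2 | h2
  · exact not_overlap hY hab.not_inBox hcd.not_inBox h1 h2 ⟨bxcd.1, bxab.2⟩ byab bycd ht0 ht1
      rfl hx rfl hy
  · exact hN.not_nested hY hab hcd h1 hXcd h2 byab bycd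
  · exact hN.not_nested hY hcd hab h1 hXab h2 bycd byab
  · exact not_overlap hY hcd.not_inBox hab.not_inBox h1 h2 ⟨bxab.1, bxcd.2⟩ bycd byab hs0 hs1
      hx rfl hy rfl

end Crossing

/-! ### Euclidean lengths and weighted graph distances. -/

section Transfer

lemma dist_eq_sqrt (p q : Plane) : dist p q = √((q 0 - p 0) ^ 2 + (q 1 - p 1) ^ 2) := by
  rw [EuclideanSpace.dist_eq, Fin.sum_univ_two, Real.dist_eq, Real.dist_eq, sq_abs, sq_abs]
  congr 1
  ring

lemma dist_le_abs_add_abs (p q : Plane) : dist p q ≤ |q 0 - p 0| + |q 1 - p 1| := by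
  rw [dist_eq_sqrt, Real.sqrt_le_left (by positivity), ← sq_abs (q 0 - p 0), ← sq_abs (q 1 - p 1)]
  nlinarith [abs_nonneg (q 0 - p 0), abs_nonneg (q 1 - p 1)]

lemma dist_le_sqrt_two_mul_max (p q : Plane) :
    dist p q ≤ √2 * max |q 0 - p 0| |q 1 - p 1| := by
  have h0 : 0 ≤ max |q 0 - p 0| |q 1 - p 1| := (abs_nonneg _).trans (le_max_left _ _)
  rw [dist_eq_sqrt, Real.sqrt_le_left (by positivity), ← sq_abs (q 0 - p 0), ← sq_abs (q 1 - p 1),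
    mul_pow, Real.sq_sqrt (by norm_num)]
  have h1 := pow_le_pow_left₀ (abs_nonneg _) (le_max_left |q 0 - p 0| |q 1 - p 1|) 2
  have h2 := pow_le_pow_left₀ (abs_nonneg _) (le_max_right |q 0 - p 0| |q 1 - p 1|) 2
  linarith

/-- Cauchy–Schwarz, with `(1 + √2)² + 1² = 4 + 2√2`. -/
lemma stretchBound_le_mul_dist (p q : Plane) :
    stretchBound (q 0 - p 0) (q 1 - p 1) ≤ √(4 + 2 * √2) * dist p q := by
  have h2 : √2 ^ 2 = 2 := Real.sq_sqrt (by norm_num)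
  rw [dist_eq_sqrt, ← Real.sqrt_mul (by positivity), stretchBound]
  refine Real.le_sqrt_of_sq_le ?_
  have key : ∀ M m : ℝ, ((1 + √2) * M + m) ^ 2 ≤ (4 + 2 * √2) * (M ^ 2 + m ^ 2) := fun M m => by
    have : (4 + 2 * √2) * (M ^ 2 + m ^ 2) - ((1 + √2) * M + m) ^ 2 =
        (M - (1 + √2) * m) ^ 2 + (2 - √2 ^ 2) * (M ^ 2 + m ^ 2) := by ring
    nlinarith [sq_nonneg (M - (1 + √2) * m)]
  rcases le_total |q 0 - p 0| |q 1 - p 1| with h | h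
  · rw [max_eq_right h, min_eq_left h, ← sq_abs (q 0 - p 0), ← sq_abs (q 1 - p 1), add_comm (_ ^ 2)]
    exact key _ _
  · rw [max_eq_left h, min_eq_right h, ← sq_abs (q 0 - p 0), ← sq_abs (q 1 - p 1)]
    exact key _ _

variable {P : Finset Plane}

lemma walkLength_nonneg {G : SimpleGraph P} {u v : P} (w : G.Walk u v) : 0 ≤ walkLength w := by
  refine List.sum_nonneg fun x hx => ?_
  obtain ⟨e, -, rfl⟩ := List.mem_map.1 hx
  exact dist_nonneg

lemma walkLength_cons {G : SimpleGraph P} {u v w : P} (h : G.Adj u v) (p : G.Walk v w) :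
    walkLength (SimpleGraph.Walk.cons h p) = dist (u : Plane) v + walkLength p := by
  simp [walkLength]

lemma walkLength_append {G : SimpleGraph P} {u v w : P} (p : G.Walk u v) (q : G.Walk v w) :
    walkLength (p.append q) = walkLength p + walkLength q := by
  simp [walkLength]

lemma graphDist_self (G : SimpleGraph P) (u : P) : graphDist G u u = 0 := by
  refine le_antisymm (iInf_le_of_le SimpleGraph.Walk.nil ?_) (zero_le)
  simp [walkLength]

lemma graphDist_triangle (G : SimpleGraph P) (u v w : P) :
    graphDist G u w ≤ graphDist G u v + graphDist G v w := by
  refine ENNReal.le_iInf_add_iInf fun p q => iInf_le_of_le (p.append q) ?_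
  rw [walkLength_append, ENNReal.ofReal_add (walkLength_nonneg _) (walkLength_nonneg _)]

lemma graphDist_le_of_adj {G : SimpleGraph P} {u v : P} (h : G.Adj u v) :
    graphDist G u v ≤ ENNReal.ofReal (dist (u : Plane) v) := by
  refine iInf_le_of_le (SimpleGraph.Walk.cons h SimpleGraph.Walk.nil) ?_
  simp [walkLength]

lemma graphDist_le_mul_of_forall_adj {G H : SimpleGraph P} {t : ℝ} (ht : 0 < t)
    (h : ∀ u v : P, G.Adj u v → graphDist H u v ≤ ENNReal.ofReal (t * dist (u : Plane) v))
    (u v : P) : graphDist H u v ≤ ENNReal.ofReal t * graphDist G u v := by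
  have key : ∀ {u v : P} (w : G.Walk u v), graphDist H u v ≤ ENNReal.ofReal (t * walkLength w) := by
    intro u v w
    induction w with
    | nil => rw [graphDist_self]; exact zero_le
    | cons hadj p ih =>
      rw [walkLength_cons, mul_add, ENNReal.ofReal_add (by positivity)
        (mul_nonneg ht.le (walkLength_nonneg _))]
      exact (graphDist_triangle H _ _ _).trans (add_le_add (h _ _ hadj) ih)
  -- Positivity of `t` matters here: without a walk the infimum is `⊤`, and `0 * ⊤ = 0`.
  rw [graphDist.eq_1 G, ENNReal.mul_iInf_of_ne (by simpa using ht) ENNReal.ofReal_ne_top]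
  refine le_iInf fun w => ?_
  rw [← ENNReal.ofReal_mul ht.le]
  exact key w

/-! ### General position and Delaunay edges in coordinates. -/

lemma GeneralPosition.injective_fst (hP : GeneralPosition P) :
    Function.Injective fun p : P => (p : Plane) 0 := by
  intro p q h
  by_contra hne
  exact hP.fst_ne p p.2 q q.2 (fun h => hne (Subtype.ext h)) h

lemma GeneralPosition.injective_snd (hP : GeneralPosition P) :
    Function.Injective fun p : P => (p : Plane) 1 := by
  intro p q h
  by_contra hne
  exact hP.snd_ne p p.2 q q.2 (fun h => hne (Subtype.ext h)) h

lemma dInf_lt_iff {p q : Plane} {r : ℝ} :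
    dInf p q < r ↔ (p 0 - r < q 0 ∧ q 0 < p 0 + r) ∧ (p 1 - r < q 1 ∧ q 1 < p 1 + r) := by
  rw [dInf, max_lt_iff, abs_lt, abs_lt]
  constructor <;> rintro ⟨⟨h1, h2⟩, h3, h4⟩ <;> refine ⟨⟨?_, ?_⟩, ?_, ?_⟩ <;> linarith

lemma dInf_le_iff {p q : Plane} {r : ℝ} :
    dInf p q ≤ r ↔ (p 0 - r ≤ q 0 ∧ q 0 ≤ p 0 + r) ∧ (p 1 - r ≤ q 1 ∧ q 1 ≤ p 1 + r) := by
  rw [dInf, max_le_iff, abs_le, abs_le]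
  constructor <;> rintro ⟨⟨h1, h2⟩, h3, h4⟩ <;> refine ⟨⟨?_, ?_⟩, ?_, ?_⟩ <;> linarith

/-- A closed square with empty interior, given by its lower left corner and side length, has all
the points of `P` that it contains on its boundary. -/
lemma onSquareBoundary_of_emptyRect {x y s : ℝ}
    (hE : EmptyRect (fun p : P => (p : Plane) 0) (fun p : P => (p : Plane) 1)
      x (x + s) y (y + s)) :
    (∀ w ∈ P, ¬ InSquareInterior !₂[x + s / 2, y + s / 2] (s / 2) w) ∧
    ∀ p : P, (x ≤ (p : Plane) 0 ∧ (p : Plane) 0 ≤ x + s ∧ y ≤ (p : Plane) 1 ∧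
      (p : Plane) 1 ≤ y + s) → OnSquareBoundary !₂[x + s / 2, y + s / 2] (s / 2) p := by
  have hint : ∀ w ∈ P, ¬ InSquareInterior !₂[x + s / 2, y + s / 2] (s / 2) w := by
    intro w hw hin
    rw [InSquareInterior, dInf_lt_iff] at hin
    simp at hin
    exact hE ⟨w, hw⟩ (by simpa using hin.1.1) (by linarith [hin.1.2]) (by simpa using hin.2.1)
      (by linarith [hin.2.2])
  refine ⟨hint, fun p ⟨h1, h2, h3, h4⟩ => le_antisymm ?_ (not_lt.1 (hint p p.2))⟩
  rw [dInf_le_iff]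
  simp
  refine ⟨⟨h1, ?_⟩, h3, ?_⟩ <;> linarith

lemma linftyDelaunay_adj_iff {u v : P} : (linftyDelaunay P).Adj u v ↔
    u ≠ v ∧ SquareEdge (fun p : P => (p : Plane) 0) (fun p : P => (p : Plane) 1) u v := by
  constructor
  · rintro ⟨hne, c, r, hr, hu, hv, hw⟩
    have hu' := dInf_le_iff.1 hu.le
    have hv' := dInf_le_iff.1 hv.le
    refine ⟨hne, c 0 - r, c 1 - r, 2 * r, by linarith, fun p h1 h2 h3 h4 => ?_,
      ⟨?_, ?_, ?_, ?_⟩, ⟨?_, ?_, ?_, ?_⟩⟩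
    · refine hw p p.2 (dInf_lt_iff.2 ⟨⟨h1, ?_⟩, h3, ?_⟩) <;> linarith
    all_goals linarith [hu'.1.1, hu'.1.2, hu'.2.1, hu'.2.2, hv'.1.1, hv'.1.2, hv'.2.1, hv'.2.2]
  · rintro ⟨hne, x, y, s, hs, hE, hu, hv⟩
    obtain ⟨h1, h2⟩ := onSquareBoundary_of_emptyRect hE
    exact ⟨hne, _, s / 2, by linarith, h2 u hu, h2 v hv, h1⟩

lemma GeneralPosition.noFour (hP : GeneralPosition P) :
    NoFour (fun p : P => (p : Plane) 0) (fun p : P => (p : Plane) 1) := by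
  intro x y s hs hE f hf hmem
  obtain ⟨-, h2⟩ := onSquareBoundary_of_emptyRect hE
  have h3 := hP.no_four_on_square !₂[x + s / 2, y + s / 2] (s / 2) (by linarith)
  have hsub : Set.range (fun i => (f i : Plane)) ⊆
      {p : Plane | p ∈ P ∧ OnSquareBoundary !₂[x + s / 2, y + s / 2] (s / 2) p} := by
    rintro _ ⟨i, rfl⟩
    exact ⟨(f i).2, h2 _ (hmem i)⟩
  have h4 := (Set.encard_le_encard hsub).trans h3
  have hinj : Function.Injective fun i => (f i : Plane) := Subtype.val_injective.comp hf
  rw [← Set.image_univ, hinj.encard_image, Set.encard_univ] at h4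
  simp only [ENat.card_eq_coe_fintype_card, Fintype.card_fin] at h4
  exact absurd h4 (by norm_num)

/-- The `L∞`-Delaunay triangulation stretches distances at most by `√(4 + 2√2)`. -/
theorem graphDist_linftyDelaunay_le (hP : GeneralPosition P) (a b : P) :
    graphDist (linftyDelaunay P) a b ≤
      ENNReal.ofReal (√(4 + 2 * √2) * dist (a : Plane) b) := by
  -- Connectivity is not known yet, so the distance is truncated at `C` to be real-valued. The
  -- triangle inequality survives, and since `C` exceeds the claimed bound by 1, the truncation
  -- cannot be what attains it.
  set C : ℝ := √(4 + 2 * √2) * dist (a : Plane) b + 1 with hC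
  have hC0 : 0 ≤ C := by positivity
  let d : P → P → ℝ := fun u v =>
    (min (graphDist (linftyDelaunay P) u v) (ENNReal.ofReal C)).toReal
  have hfin : ∀ u v, min (graphDist (linftyDelaunay P) u v) (ENNReal.ofReal C) ≠ ⊤ :=
    fun u v => ne_top_of_le_ne_top ENNReal.ofReal_ne_top (min_le_right _ _)
  have hself : ∀ p, d p p = 0 := fun p => by simp [d, graphDist_self]
  have htri : ∀ p q r, d p r ≤ d p q + d q r := fun p q r => by
    simp only [d]
    rw [← ENNReal.toReal_add (hfin _ _) (hfin _ _)]
    refine ENNReal.toReal_mono (ENNReal.add_ne_top.2 ⟨hfin _ _, hfin _ _⟩) ?_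
    rcases le_total (graphDist (linftyDelaunay P) p q) (ENNReal.ofReal C) with h1 | h1
    · rcases le_total (graphDist (linftyDelaunay P) q r) (ENNReal.ofReal C) with h2 | h2
      · rw [min_eq_left h1, min_eq_left h2]
        exact (min_le_left _ _).trans (graphDist_triangle _ _ _ _)
      · rw [min_eq_right h2]
        exact (min_le_right _ _).trans le_add_self
    · rw [min_eq_right h1]
      exact (min_le_right _ _).trans le_self_add
  have hedge : ∀ p q : P,
      SquareEdge (fun p : P => (p : Plane) 0) (fun p : P => (p : Plane) 1) p q →
      d p q ≤ dist (p : Plane) q := fun p q hpq => by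
    by_cases hne : p = q
    · subst hne; simp [hself]
    · refine ENNReal.toReal_le_of_le_ofReal dist_nonneg ((min_le_left _ _).trans ?_)
      exact graphDist_le_of_adj (linftyDelaunay_adj_iff.2 ⟨hne, hpq⟩)
  have hlip : ∀ p, EdgeLipschitz (fun p : P => (p : Plane) 0) (fun p : P => (p : Plane) 1)
      (d p) := fun p =>
    ⟨fun q r h => by linarith [htri p q r, hedge q r h, dist_le_abs_add_abs (q : Plane) r],
      fun q r h => by linarith [htri p q r, hedge q r h, dist_le_sqrt_two_mul_max (q : Plane) r]⟩
  have hle := (le_stretchBound hP.injective_fst hP.injective_snd hself htri hlip a b).trans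
    (stretchBound_le_mul_dist (a : Plane) b)
  have hle' := (ENNReal.le_ofReal_iff_toReal_le (hfin a b) (by positivity)).2 hle
  rcases min_le_iff.1 hle' with h | h
  · exact h
  · rw [ENNReal.ofReal_le_ofReal_iff (by positivity)] at h
    linarith

/-! ### Yao edges in coordinates. -/

/-- The square with lower left corner `u` and side the L∞-distance to `v` works: a point in its
interior would be a closer one in the same quadrant. -/
lemma squareEdge_of_nearest {ι : Type*} {X Y : ι → ℝ} {u v : ι} (hX : X u < X v) (hY : Y u < Y v)
    (h : ∀ w, X u < X w → Y u < Y w →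
      max (X v - X u) (Y v - Y u) ≤ max (X w - X u) (Y w - Y u)) : SquareEdge X Y u v := by
  have h1 := le_max_left (X v - X u) (Y v - Y u)
  have h2 := le_max_right (X v - X u) (Y v - Y u)
  refine ⟨X u, Y u, max (X v - X u) (Y v - Y u), by linarith, fun w w1 w2 w3 w4 => ?_,
    ⟨?_, ?_, ?_, ?_⟩, ⟨?_, ?_, ?_, ?_⟩⟩
  · exact absurd (h w w1 w3) (not_le.2 (max_lt (by linarith) (by linarith)))
  all_goals linarith

lemma dInf_eq {u p : Plane} {f g : ℝ} (hf : |u 0 - p 0| = f) (hg : |u 1 - p 1| = g) :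
    dInf u p = max f g := by
  rw [dInf, hf, hg]

lemma abs_sub_eq_of_lt {a b : ℝ} (h : a < b) : |a - b| = b - a := by
  rw [abs_of_neg (by linarith)]; ring

lemma abs_sub_eq_of_gt {a b : ℝ} (h : b < a) : |a - b| = -b - -a := by
  rw [abs_of_pos (by linarith)]; ring

lemma cone_unique {u v : Plane} {i j : Fin 4} (hi : v ∈ cone u i) (hj : v ∈ cone u j) :
    i = j := by
  fin_cases i <;> fin_cases j <;> first | rfl | (simp [cone] at hi hj; linarith [hi.1, hi.2, hj.1, hj.2])

/-- A point and a nearest point in one of its cones lie in a common empty square. -/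
lemma IsNearestInCone.squareEdge {u v : P} {i : Fin 4} (h : IsNearestInCone P u i v) :
    SquareEdge (fun p : P => (p : Plane) 0) (fun p : P => (p : Plane) 1) u v := by
  obtain ⟨-, hv, hmin⟩ := h
  have e := @abs_sub_eq_of_lt
  have e' := @abs_sub_eq_of_gt
  fin_cases i
  · refine squareEdge_of_nearest hv.1 hv.2 fun w h1 h2 => ?_
    have := hmin w w.2 ⟨h1, h2⟩
    rwa [dInf_eq (e hv.1) (e hv.2), dInf_eq (e h1) (e h2)] at this
  · refine SquareEdge.of_neg_left (squareEdge_of_nearest (neg_lt_neg hv.1) hv.2 fun w h1 h2 => ?_)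
    have h1 := neg_lt_neg_iff.1 h1
    have := hmin w w.2 ⟨h1, h2⟩
    rwa [dInf_eq (e' hv.1) (e hv.2), dInf_eq (e' h1) (e h2)] at this
  · refine SquareEdge.of_neg_left (SquareEdge.of_neg_right
      (squareEdge_of_nearest (neg_lt_neg hv.1) (neg_lt_neg hv.2) fun w h1 h2 => ?_))
    have h1 := neg_lt_neg_iff.1 h1
    have h2 := neg_lt_neg_iff.1 h2
    have := hmin w w.2 ⟨h1, h2⟩
    rwa [dInf_eq (e' hv.1) (e' hv.2), dInf_eq (e' h1) (e' h2)] at this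
  · refine SquareEdge.of_neg_right (squareEdge_of_nearest hv.1 (neg_lt_neg hv.2) fun w h1 h2 => ?_)
    have h2 := neg_lt_neg_iff.1 h2
    have := hmin w w.2 ⟨h1, h2⟩
    rwa [dInf_eq (e hv.1) (e' hv.2), dInf_eq (e h1) (e' h2)] at this

lemma IsDirectedYao.exists_nearest {D : Digraph P} (hD : IsDirectedYao P D) {u w : P} {i : Fin 4}
    (hw : (w : Plane) ∈ cone u i) : ∃ v : P, (undirected D).Adj u v ∧ (v : Plane) ∈ cone u i ∧
      ∀ w : P, (w : Plane) ∈ cone u i → dInf u v ≤ dInf u w := by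
  obtain ⟨v, ⟨hv1, hv2⟩, -⟩ := hD.chosen u i ⟨w, w.2, hw⟩
  obtain ⟨j, hj⟩ := hD.nearest u v hv2
  obtain rfl := cone_unique hv1 hj.2.1
  refine ⟨v, ⟨?_, Or.inl hv2⟩, hv1, fun w hw => hj.2.2 w w.2 hw⟩
  rintro rfl
  fin_cases i <;> exact lt_irrefl _ hv1.1

lemma IsDirectedYao.yaoRelated {D : Digraph P} (hD : IsDirectedYao P D) :
    YaoRelated (fun p : P => (p : Plane) 0) (fun p : P => (p : Plane) 1)
      (undirected D).Adj := by
  have e := @abs_sub_eq_of_lt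
  have e' := @abs_sub_eq_of_gt
  refine ⟨fun _ _ h => h.symm, ?_, ?_, ?_, ?_⟩ <;> rintro u ⟨w, hw1, hw2⟩
  · obtain ⟨v, hA, hv, hmin⟩ := hD.exists_nearest (u := u) (w := w) (i := 0) ⟨hw1, hw2⟩
    refine ⟨v, hv.1, hv.2, hA, fun w h1 h2 => ?_⟩
    have := hmin w ⟨h1, h2⟩
    rwa [dInf_eq (e hv.1) (e hv.2), dInf_eq (e h1) (e h2)] at this
  · obtain ⟨v, hA, hv, hmin⟩ := hD.exists_nearest (u := u) (w := w) (i := 1)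
      ⟨neg_lt_neg_iff.1 hw1, hw2⟩
    refine ⟨v, neg_lt_neg hv.1, hv.2, hA, fun w h1 h2 => ?_⟩
    have h1 := neg_lt_neg_iff.1 h1
    have := hmin w ⟨h1, h2⟩
    rwa [dInf_eq (e' hv.1) (e hv.2), dInf_eq (e' h1) (e h2)] at this
  · obtain ⟨v, hA, hv, hmin⟩ := hD.exists_nearest (u := u) (w := w) (i := 2)
      ⟨neg_lt_neg_iff.1 hw1, neg_lt_neg_iff.1 hw2⟩
    refine ⟨v, neg_lt_neg hv.1, neg_lt_neg hv.2, hA, fun w h1 h2 => ?_⟩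
    have h1 := neg_lt_neg_iff.1 h1
    have h2 := neg_lt_neg_iff.1 h2
    have := hmin w ⟨h1, h2⟩
    rwa [dInf_eq (e' hv.1) (e' hv.2), dInf_eq (e' h1) (e' h2)] at this
  · obtain ⟨v, hA, hv, hmin⟩ := hD.exists_nearest (u := u) (w := w) (i := 3)
      ⟨hw1, neg_lt_neg_iff.1 hw2⟩
    refine ⟨v, hv.1, neg_lt_neg hv.2, hA, fun w h1 h2 => ?_⟩
    have h2 := neg_lt_neg_iff.1 h2
    have := hmin w ⟨h1, h2⟩
    rwa [dInf_eq (e hv.1) (e' hv.2), dInf_eq (e h1) (e' h2)] at this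

/-- The Yao graph is contained in the Delaunay triangulation. -/
theorem IsYao.le_linftyDelaunay {Y : SimpleGraph P} (hY : IsYao P Y) : Y ≤ linftyDelaunay P := by
  obtain ⟨D, hD, rfl⟩ := hY
  rintro u v ⟨hne, h | h⟩
  · obtain ⟨i, hi⟩ := hD.nearest u v h
    exact linftyDelaunay_adj_iff.2 ⟨hne, hi.squareEdge⟩
  · obtain ⟨i, hi⟩ := hD.nearest v u h
    exact linftyDelaunay_adj_iff.2 ⟨hne, hi.squareEdge.symm⟩

/-- The Delaunay triangulation is plane. -/
theorem isPlane_linftyDelaunay (hP : GeneralPosition P) : IsPlane (linftyDelaunay P) := by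
  have ordered : ∀ a b c d : P, (linftyDelaunay P).Adj a b → (linftyDelaunay P).Adj c d →
      s(a, b) ≠ s(c, d) → (a : Plane) 0 < (b : Plane) 0 → (c : Plane) 0 < (d : Plane) 0 →
      segment ℝ (a : Plane) b ∩ segment ℝ (c : Plane) d ⊆ ({↑a, ↑b} ∩ {↑c, ↑d} : Set Plane) := by
    rintro a b c d hab hcd hne hXab hXcd z ⟨hz1, hz2⟩
    rw [segment_eq_image'] at hz1 hz2
    obtain ⟨t, ⟨ht0, ht1⟩, rfl⟩ := hz1
    obtain ⟨s, ⟨hs0, hs1⟩, hst⟩ := hz2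
    have hx := congrArg (fun z : Plane => z 0) hst
    have hy := congrArg (fun z : Plane => z 1) hst
    simp only [PiLp.add_apply, PiLp.smul_apply, PiLp.sub_apply, smul_eq_mul] at hx hy
    obtain ⟨h1, h2⟩ := hP.noFour.endpoints_of_meet hP.injective_fst hP.injective_snd
      (linftyDelaunay_adj_iff.1 hab).2 (linftyDelaunay_adj_iff.1 hcd).2 hXab hXcd
      (by rintro ⟨rfl, rfl⟩; exact hne rfl) ht0 ht1 hs0 hs1 hx.symm hy.symm
    constructor
    · rcases h1 with rfl | rfl <;> simp
    · beta_reduce at hst ⊢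
      rw [← hst]
      rcases h2 with rfl | rfl <;> simp
  have half : ∀ a b c d : P, (linftyDelaunay P).Adj a b → (linftyDelaunay P).Adj c d →
      s(a, b) ≠ s(c, d) → (a : Plane) 0 < (b : Plane) 0 →
      segment ℝ (a : Plane) b ∩ segment ℝ (c : Plane) d ⊆ ({↑a, ↑b} ∩ {↑c, ↑d} : Set Plane) := by
    intro a b c d hab hcd hne hXab
    rcases lt_or_gt_of_ne (hP.injective_fst.ne hcd.ne) with h | h
    · exact ordered a b c d hab hcd hne hXab h
    · rw [segment_symm ℝ (c : Plane), Set.pair_comm (c : Plane)]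
      exact ordered a b d c hab hcd.symm (by rwa [Sym2.eq_swap (a := d)]) hXab h
  intro a b c d hab hcd hne
  rcases lt_or_gt_of_ne (hP.injective_fst.ne hab.ne) with h | h
  · exact half a b c d hab hcd hne h
  · rw [segment_symm ℝ (a : Plane), Set.pair_comm (a : Plane)]
    exact half b a c d hab.symm hcd (by rwa [Sym2.eq_swap (a := b)]) h

/-- The Yao graph is a `(1 + √2)`-spanner of the Delaunay triangulation. -/
theorem IsYao.graphDist_le (hP : GeneralPosition P) {Y : SimpleGraph P} (hY : IsYao P Y)
    (u v : P) :
    graphDist Y u v ≤ ENNReal.ofReal (1 + √2) * graphDist (linftyDelaunay P) u v := by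
  have h0 : 0 ≤ √2 := Real.sqrt_nonneg 2
  refine graphDist_le_mul_of_forall_adj (by positivity) (fun u v huv => ?_) u v
  obtain ⟨hne, hsq⟩ := linftyDelaunay_adj_iff.1 huv
  obtain ⟨D, hD, rfl⟩ := hY
  rcases hD.yaoRelated.exists_short_detour hP.injective_fst hP.injective_snd hne hsq with
    h | ⟨q, huq, hqv, hlen⟩
  · refine (graphDist_le_of_adj h).trans (ENNReal.ofReal_le_ofReal ?_)
    nlinarith [dist_nonneg (x := (u : Plane)) (y := v)]
  · rw [← dist_eq_sqrt, ← dist_eq_sqrt, ← dist_eq_sqrt] at hlen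
    refine (graphDist_triangle _ u q v).trans ((add_le_add (graphDist_le_of_adj huq)
      (graphDist_le_of_adj hqv)).trans ?_)
    rw [← ENNReal.ofReal_add dist_nonneg dist_nonneg]
    exact ENNReal.ofReal_le_ofReal hlen

end Transfer

theorem mainTheorem2 (P : Finset Plane) (hP : GeneralPosition P)
    (Y : SimpleGraph P) (hY : IsYao P Y) :
    Y ≤ linftyDelaunay P ∧
    IsPlane Y ∧
    IsSpannerOf (1 + √2) Y (linftyDelaunay P) ∧
    IsSpannerOf ((1 + √2) * √(4 + 2 * √2)) Y (completeEuclidean P) := by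
  have h0 : 0 ≤ √2 := Real.sqrt_nonneg 2
  have hle := hY.le_linftyDelaunay
  refine ⟨hle, fun a b c d hab hcd => isPlane_linftyDelaunay hP a b c d (hle hab) (hle hcd),
    ⟨hle, hY.graphDist_le hP⟩, le_top, ?_⟩
  refine graphDist_le_mul_of_forall_adj (by positivity) fun u v _ => ?_
  rw [mul_assoc, ENNReal.ofReal_mul (by positivity)]
  exact (hY.graphDist_le hP u v).trans (by gcongr; exact graphDist_linftyDelaunay_le hP u v)
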